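/- Let $S$ be a finite set and let $\Gamma$ be a finite simple graph with vertex set $S$ whose edges $\{s,t\}$ are labelled by integers $m_{st}=m_{ts}\ge 2$; put $m_{st}=\infty$ if $s\ne t$ are not joined by an edge. Let $$A_\Gamma^+=\langle S\mid \underbrace{sts\cdots}_{m_{st}}=\underbrace{tst\cdots}_{m_{st}}\text{ for every edge }\{s,t\}\rangle^+$$ be the associated Artin monoid. For $T\subseteq S$ let $A_T^+$ be the submonoid of $A_\Gamma^+$ generated by $T$, and call $T$ spherical if the Coxeter group of the full labelled subgraph of $\Gamma$ spanned by $T$ is finite. For $\alpha\in A_\Gamma^+$ let the monoid coset $[\alpha]_T\subseteq A_\Gamma^+$ be the class of $\alpha$ under the transitive closure of the relation: $\alpha\sim_T\beta$ if and only if $\alpha t=\beta t'$ for some $t,t'\in A_T^+$. The monoid Deligne complex $\mathcal{D}_\Gamma^+$ is the cube complex whose vertices are the cosets $[\alpha]_T$ with $\alpha\in A_\Gamma^+$ and $T\subseteq S$ spherical, partially ordered by inclusion, and which has one cube $[0,1]^{T_2\setminus T_1}$ for each interval $[[\alpha]_{T_1},[\alpha]_{T_2}]$ with $T_1\subseteq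 T_2$ spherical; the corner of this cube with coordinates $1$ on $R\setminus T_1$ and $0$ on $T_2\setminus R$ is the vertex $[\alpha]_R$ $(T_1\subseteq R\subseteq T_2)$, and the cube of a subinterval is glued to the corresponding face. It carries the quotient topology of the disjoint union of its cubes. **Theorem 4.1.** For every such $\Gamma$, the monoid Deligne complex $\mathcal{D}_\Gamma^+$ of the Artin monoid $A_\Gamma^+$ is contractible. -/

import Mathlib

namespace ArtinDeligne

universe u

/-- The defining relations `sts⋯ = tst⋯` (`m s t` letters on each side) of the Artin monoid, one for
each pair of distinct generators `s, t` with `m s t ≠ ∞`. Labelled graphs are encoded by Coxeter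
matrices, in which the value `0` stands for `∞` (no edge); `CoxeterSystem.braidWord M s t` is the
alternating word in `s, t` with `m s t` letters, ending in `t`. -/
inductive BraidRel {S : Type u} (M : CoxeterMatrix S) : FreeMonoid S → FreeMonoid S → Prop
  | braid (s t : S) (hne : s ≠ t) (hst : M s t ≠ 0) :
      BraidRel M (FreeMonoid.ofList (CoxeterSystem.braidWord M s t))
        (FreeMonoid.ofList (CoxeterSystem.braidWord M t s))

/-- The Artin monoid of the labelled graph encoded by `M`. -/
abbrev ArtinMonoid {S : Type u} (M : CoxeterMatrix S) : Type u :=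
  PresentedMonoid (BraidRel M)

/-- The standard generator of the Artin monoid attached to `s`. -/
def gen {S : Type u} (M : CoxeterMatrix S) (s : S) : ArtinMonoid M :=
  PresentedMonoid.of (BraidRel M) s

/-- The Coxeter matrix of the full labelled subgraph spanned by `T`. -/
def restrict {S : Type u} (M : CoxeterMatrix S) (T : Set S) : CoxeterMatrix T where
  M := Matrix.of fun s t => M s t
  isSymm := Matrix.IsSymm.ext fun s t => M.symmetric t s
  diagonal s := M.diagonal s
  off_diagonal s t h := M.off_diagonal s t fun h' => h (Subtype.ext h')

/-- `T` is spherical (of finite type): the Coxeter group of the full subgraph on `T` is finite. -/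
def IsSpherical {S : Type u} (M : CoxeterMatrix S) (T : Set S) : Prop :=
  Finite (restrict M T).Group

/-- The submonoid `A_T⁺` generated by the elements of `T`. -/
def parabolic {S : Type u} (M : CoxeterMatrix S) (T : Set S) : Submonoid (ArtinMonoid M) :=
  Submonoid.closure (gen M '' T)

/-- The relation `α ∼_T β`: `α t = β t'` for some `t, t'` in `A_T⁺`. -/
def CosetStep {S : Type u} (M : CoxeterMatrix S) (T : Set S) (α β : ArtinMonoid M) : Prop :=
  ∃ t ∈ parabolic M T, ∃ t' ∈ parabolic M T, α * t = β * t'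

/-- The monoid coset `[α]_T`: the class of `α` under the transitive closure of `∼_T`. -/
def coset {S : Type u} (M : CoxeterMatrix S) (α : ArtinMonoid M) (T : Set S) :
    Set (ArtinMonoid M) :=
  {β | Relation.TransGen (CosetStep M T) α β}

/-- The vertices of the monoid Deligne complex: the cosets `[α]_T` with `T` spherical. As a subtype
of a type of sets it is partially ordered by inclusion. -/
abbrev Vertex {S : Type u} (M : CoxeterMatrix S) : Type u :=
  {C : Set (ArtinMonoid M) // ∃ T : Set S, IsSpherical M T ∧ ∃ α, C = coset M α T}

/-- The spherical set `T` with `v = [α]_T` for some `α` (the coset determines `T`). -/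
noncomputable def Vertex.type {S : Type u} {M : CoxeterMatrix S} (v : Vertex M) : Set S :=
  v.2.choose

theorem Vertex.type_spec {S : Type u} {M : CoxeterMatrix S} (v : Vertex M) :
    IsSpherical M v.type ∧ ∃ α, v.1 = coset M α v.type :=
  v.2.choose_spec

/-- The vertex `[α]_T`. -/
def Vertex.mk {S : Type u} {M : CoxeterMatrix S} (α : ArtinMonoid M) (T : Set S)
    (hT : IsSpherical M T) : Vertex M :=
  ⟨coset M α T, T, hT, α, rfl⟩

/-- An interval `[bot, top]` of the poset of vertices; it indexes one cube. (Comparable vertices have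
a common representative, so these are exactly the intervals `[[α]_{T₁}, [α]_{T₂}]`.) -/
structure Interval {S : Type u} (M : CoxeterMatrix S) : Type u where
  bot : Vertex M
  top : Vertex M
  le : bot ≤ top

/-- The standard cube `[0,1]^(T₂ ∖ T₁)` attached to the interval `[[α]_{T₁}, [α]_{T₂}]`. Its corner
with coordinates `1` on `R ∖ T₁` and `0` elsewhere is the vertex `[α]_R`, for `T₁ ⊆ R ⊆ T₂`. -/
abbrev Cube {S : Type u} {M : CoxeterMatrix S} (I : Interval M) : Type u :=
  ↥(I.top.type \ I.bot.type) → unitInterval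

/-- `J` is a subinterval of `I`, so that the cube of `J` is a face of the cube of `I`. -/
def IsFace {S : Type u} {M : CoxeterMatrix S} (J I : Interval M) : Prop :=
  I.bot ≤ J.bot ∧ J.top ≤ I.top

open scoped Classical in
/-- The inclusion of the cube of a subinterval `J = [[α]_{R₁}, [α]_{R₂}]` of
`I = [[α]_{T₁}, [α]_{T₂}]` as a face: the coordinates in `R₂ ∖ R₁` are kept, those in `R₁ ∖ T₁` are
`1`, and those in `T₂ ∖ R₂` are `0`. -/
noncomputable def faceMap {S : Type u} {M : CoxeterMatrix S} (J I : Interval M) (x : Cube J) :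
    Cube I := fun s =>
  if hbot : s.1 ∈ J.bot.type then 1
  else if htop : s.1 ∈ J.top.type then x ⟨s.1, htop, hbot⟩
  else 0

/-- The gluing: each point of the cube of a subinterval is identified with its image in the
corresponding face of the bigger cube. -/
inductive Glue {S : Type u} (M : CoxeterMatrix S) :
    (Σ I : Interval M, Cube I) → (Σ I : Interval M, Cube I) → Prop
  | face (J I : Interval M) (h : IsFace J I) (x : Cube J) : Glue M ⟨J, x⟩ ⟨I, faceMap J I x⟩

/-- The monoid Deligne complex: the disjoint union of the cubes of all intervals, modulo the
equivalence relation generated by the gluing, with the quotient topology. -/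
abbrev MonoidDeligneComplex {S : Type u} (M : CoxeterMatrix S) : Type u :=
  Quot (Glue M)

end ArtinDeligne

/-!
The monoid Deligne complex is a development: it is glued from copies `a K` of one chamber `K`,
labelled by the elements `a` of the Artin monoid, where `K` is the set of the points of `[0,1]^S`
with spherical support. The points `x` of `a K` and `b K` are identified when `a` and `b` lie in
the same coset of type `{s | x s = 1}` (`homeomorphDevelopment`).

If no generator from `T` divides `a` on the right, then `[a]_T = a A_T⁺`, so `a` is the unique
shortest element of its coset (`exists_eq_mul_of_coset_eq`). Hence `a K` meets the union of the
other chambers whose label is not longer than `a` exactly in the walls `x s = 1` with `s` in the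
set `E` of the generators that divide `a` on the right (`finalSet`), and along each of these walls
a chamber with a shorter label is adjacent. The set `E` is spherical (`isSpherical_finalSet`).
Therefore `K` has an explicit strong deformation retraction onto the union of those walls
(`push`): scale down the coordinates outside `E`, and raise those in `E` until one of them reaches
`1`. For `a = 1` the set `E` is empty, and the same formula contracts `K` to a point. Running the
retractions by decreasing length of `a`, that for length `n` during the time from `1/(n+2)` to
`1/(n+1)`, contracts the complex (`flow`). Each point takes part in finitely many stages only, and
continuity may be checked on each `a K × [0,1]`, since the unit interval is locally compact.

The algebraic input is the existence of least common left multiples: if `a s = b t` with `s ≠ t`,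
both sides pass through the braid word of `s` and `t` (`lcmRel_of_mul_gen_eq`). This is proved by
induction on the length. It amounts to the transitivity of the relation `LcmRel`, where a product
`d r` is compared with both `a s` and `b t`; the three generators are handled inside the Coxeter
group, as follows. Among the `v` in the Coxeter group whose lifts divide `d` on the right and for
which `v r` is longer than `v`, there is one that extends the two which come from `s` and `t`
(`exists_isSuffix_isSuffix`); then `s` and `t` are right descents of `v r`, which therefore ends
in their braid word (`exists_eq_mul_braidWord`). The facts on Coxeter groups that are needed are
the order of `s t` (from the geometric representation), the exchange condition (from the action on
signed elements of the group) and Matsumoto's theorem (`word_eq_word_of_isReduced`). The latter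
also shows that reduced words of a full subgraph stay reduced (`isReduced_map`), so that subsets
of spherical sets are spherical and `E` is spherical: all its reduced words are suffixes of a
single element.
-/

namespace ArtinDeligne

universe u v

/-! ### The order of a product of two simple reflections -/

section Order

variable {B : Type u} (M : CoxeterMatrix B)

/-- The contragredient of the geometric representation of a Coxeter group, on functions `B → ℝ`:
the generator `s` acts by `φ ↦ φ + φ(s) c_s`, where `c_s(r) = 2 cos (π / M s r)`. On the diagonal
this is `-2`, and for `M s r = ∞`, encoded as `0`, the convention `π / 0 = 0` gives the right value
`2`. -/
noncomputable def dualReflection (s : B) : Function.End (B → ℝ) :=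
  fun φ r => φ r + 2 * Real.cos (Real.pi / M s r) * φ s

theorem dualReflection_apply (s : B) (φ : B → ℝ) (r : B) :
    dualReflection M s φ r = φ r + 2 * Real.cos (Real.pi / M s r) * φ s := rfl

theorem cos_pi_div_diagonal (s : B) : 2 * Real.cos (Real.pi / M s s) = -2 := by
  simp

theorem dualReflection_mul_pow_apply {s t : B} (φ : B → ℝ) (z : ℕ → ℝ)
    (hz : ∀ n, z (n + 2) = 2 * Real.cos (Real.pi / M s t) * z (n + 1) - z n)
    (h0 : z 0 = -φ s) (h1 : z 1 = φ t) (k : ℕ) :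
    ((dualReflection M s * dualReflection M t) ^ k) φ s = -z (2 * k) ∧
    ((dualReflection M s * dualReflection M t) ^ k) φ t = z (2 * k + 1) ∧
    ∀ r, ((dualReflection M s * dualReflection M t) ^ k) φ r = φ r
      + 2 * Real.cos (Real.pi / M t r) * ∑ j ∈ Finset.range k, z (2 * j + 1)
      + 2 * Real.cos (Real.pi / M s r) * ∑ j ∈ Finset.range k, z (2 * j + 2) := by
  induction k with
  | zero => simp [h0, h1, Function.End.one_def]
  | succ k ih =>
    obtain ⟨ihs, iht, ihr⟩ := ih
    have step : ∀ r, ((dualReflection M s * dualReflection M t) ^ (k + 1)) φ r =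
        ((dualReflection M s * dualReflection M t) ^ k) φ r
          + 2 * Real.cos (Real.pi / M t r) * z (2 * k + 1)
          + 2 * Real.cos (Real.pi / M s r) * z (2 * k + 2) := by
      intro r
      rw [pow_succ']
      change dualReflection M s (dualReflection M t _) r = _
      simp only [dualReflection_apply, ihs, iht, hz (2 * k), M.symmetric t s]
      ring
    refine ⟨?_, ?_, ?_⟩
    · rw [step, ihs, cos_pi_div_diagonal, M.symmetric t s]
      have := hz (2 * k)
      rw [show 2 * (k + 1) = 2 * k + 2 by ring]
      linarith
    · rw [step, iht, cos_pi_div_diagonal]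
      have := hz (2 * k + 1)
      rw [show 2 * (k + 1) + 1 = 2 * k + 1 + 2 by ring]
      rw [show 2 * k + 2 = 2 * k + 1 + 1 by ring]
      linarith
    · intro r
      rw [step, ihr, Finset.sum_range_succ, Finset.sum_range_succ]
      ring

theorem sum_sin_add_two_mul_eq_zero {m : ℕ} (hm : 2 ≤ m) (x : ℝ) :
    ∑ j ∈ Finset.range m, Real.sin (x + 2 * j * (Real.pi / m)) = 0 := by
  have hm0 : (m : ℝ) ≠ 0 := by positivity
  have hs : 0 < Real.sin (Real.pi / m) := by
    apply Real.sin_pos_of_pos_of_lt_pi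
    · positivity
    · apply div_lt_self Real.pi_pos; exact_mod_cast hm
  have key : ∀ j : ℕ, Real.sin (x + 2 * j * (Real.pi / m)) =
      (Real.cos (x - Real.pi / m + 2 * (j : ℕ) * (Real.pi / m)) -
        Real.cos (x - Real.pi / m + 2 * ((j + 1 : ℕ) : ℝ) * (Real.pi / m))) *
        (1 / (2 * Real.sin (Real.pi / m))) := by
    intro j
    rw [show x - Real.pi / m + 2 * (j : ℕ) * (Real.pi / m) =
      (x + 2 * j * (Real.pi / m)) - Real.pi / m by ring,
      show x - Real.pi / m + 2 * ((j + 1 : ℕ) : ℝ) * (Real.pi / m) =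
      (x + 2 * j * (Real.pi / m)) + Real.pi / m by push_cast; ring]
    generalize x + 2 * j * (Real.pi / m) = y
    rw [Real.cos_sub, Real.cos_add]
    field_simp
    ring
  rw [Finset.sum_congr rfl fun j _ => key j, ← Finset.sum_mul,
    Finset.sum_range_sub' fun j : ℕ => Real.cos (x - Real.pi / m + 2 * (j : ℝ) * (Real.pi / m))]
  rw [show x - Real.pi / m + 2 * (m : ℝ) * (Real.pi / m) = x - Real.pi / m + 2 * Real.pi by
    field_simp]
  simp

theorem isLiftable_dualReflection : M.IsLiftable (dualReflection M) := by
  intro s t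
  by_cases hst : s = t
  · subst hst
    rw [M.diagonal, pow_one]
    funext φ r
    change dualReflection M s (dualReflection M s φ) r = φ r
    simp only [dualReflection_apply, cos_pi_div_diagonal]
    ring
  rcases Nat.eq_zero_or_pos (M s t) with h | h
  · rw [h, pow_zero]
  have hm : 2 ≤ M s t := by have := M.off_diagonal s t hst; omega
  funext φ r
  set θ := Real.pi / M s t with hθ
  have hs : 0 < Real.sin θ := by
    apply Real.sin_pos_of_pos_of_lt_pi
    · positivity
    · apply div_lt_self Real.pi_pos; exact_mod_cast hm
  obtain ⟨-, -, h⟩ := dualReflection_mul_pow_apply M φ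
    (fun n : ℕ => (φ t * Real.sin (n * θ) + φ s * Real.sin (n * θ - θ)) / Real.sin θ) (s := s)
    (t := t) (by
      intro n
      rw [← hθ]
      push_cast
      rw [show ((n : ℝ) + 2) * θ = (n * θ + θ) + θ by ring,
        show ((n : ℝ) + 1) * θ = n * θ + θ by ring]
      rw [show (n : ℝ) * θ + θ + θ - θ = n * θ + θ by ring,
        show (n : ℝ) * θ + θ - θ = n * θ by ring]
      rw [Real.sin_add (n * θ + θ), Real.sin_sub, Real.cos_add, Real.sin_add]
      field_simp
      linear_combination (-φ t * Real.sin (n * θ)) * Real.sin_sq_add_cos_sq θ) (by simp; field_simp)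
    (by simp; field_simp) (M s t)
  rw [h]
  have h1 : ∀ x : ℝ, ∑ j ∈ Finset.range (M s t), Real.sin (x + 2 * j * θ) = 0 :=
    sum_sin_add_two_mul_eq_zero hm
  rw [← Finset.sum_div, ← Finset.sum_div, Finset.sum_add_distrib, Finset.sum_add_distrib]
  simp_rw [← Finset.mul_sum]
  have e1 := h1 θ
  have e2 := h1 0
  have e3 := h1 (2 * θ)
  have r1 : ∀ j : ℕ, ((2 * j + 1 : ℕ) : ℝ) * θ = θ + 2 * j * θ := by intro j; push_cast; ring
  have r2 : ∀ j : ℕ, ((2 * j + 2 : ℕ) : ℝ) * θ = 2 * θ + 2 * j * θ := by intro j; push_cast; ring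
  have r3 : ∀ j : ℕ, θ + 2 * j * θ - θ = 0 + 2 * j * θ := by intro j; ring
  have r4 : ∀ j : ℕ, 2 * θ + 2 * j * θ - θ = θ + 2 * j * θ := by intro j; ring
  simp_rw [r1, r2, r3, r4, e1, e2, e3]
  simp
  rfl

variable {M} {W : Type v} [Group W] (cs : CoxeterSystem M W)

/-- Together with the relation `(s t) ^ M s t = 1`: the order of `s t` is exactly `M s t`, where `0`
stands for infinite order. The power is tested on a function that vanishes at `s`. -/
theorem dvd_of_simple_mul_simple_pow_eq_one {s t : B} {k : ℕ} (hst : s ≠ t)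
    (h : (cs.simple s * cs.simple t) ^ k = 1) : M s t ∣ k := by
  classical
  have h' := congrArg (cs.lift ⟨_, isLiftable_dualReflection M⟩) h
  rw [map_pow, map_mul, cs.lift_apply_simple, cs.lift_apply_simple, map_one] at h'
  let φ : B → ℝ := Pi.single t 1
  have hφs : φ s = 0 := by simp [φ, hst]
  have hφt : φ t = 1 := by simp [φ]
  rcases Nat.eq_zero_or_pos (M s t) with h0 | h0
  · obtain ⟨h2, -, -⟩ := dualReflection_mul_pow_apply M φ (fun n : ℕ => (n : ℝ)) (s := s) (t := t)
      (by intro n; rw [h0]; push_cast; simp; ring) (by simp [hφs]) (by simp [hφt]) k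
    rw [h'] at h2
    change φ s = _ at h2
    rw [hφs] at h2
    have : k = 0 := by
      have : (k : ℝ) = 0 := by push_cast at h2; linarith
      exact_mod_cast this
    simp [this]
  have hm : 2 ≤ M s t := by have := M.off_diagonal s t hst; omega
  set θ := Real.pi / M s t with hθ
  have hs : 0 < Real.sin θ := by
    apply Real.sin_pos_of_pos_of_lt_pi
    · positivity
    · apply div_lt_self Real.pi_pos; exact_mod_cast hm
  obtain ⟨h2, h3, -⟩ := dualReflection_mul_pow_apply M φ
    (fun n : ℕ => Real.sin (n * θ) / Real.sin θ) (s := s) (t := t) (by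
      intro n
      rw [← hθ]
      push_cast
      rw [show ((n : ℝ) + 2) * θ = (n * θ + θ) + θ by ring,
        show ((n : ℝ) + 1) * θ = n * θ + θ by ring]
      rw [Real.sin_add (n * θ + θ), Real.cos_add, Real.sin_add]
      field_simp
      linear_combination (-Real.sin (n * θ)) * Real.sin_sq_add_cos_sq θ) (by simp [hφs])
    (by simp [hφt, hs.ne']) k
  rw [h'] at h2 h3
  change φ s = _ at h2
  change φ t = _ at h3
  rw [hφs] at h2
  rw [hφt] at h3
  have h4 : Real.sin ((2 * k : ℕ) * θ) = 0 := by
    field_simp at h2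
    linarith
  have h5 : Real.cos ((2 * k : ℕ) * θ) = 1 := by
    have h3' : Real.sin ((2 * k + 1 : ℕ) * θ) = Real.sin θ := by
      field_simp at h3
      linarith
    rw [show ((2 * k + 1 : ℕ) : ℝ) * θ = (2 * k : ℕ) * θ + θ by push_cast; ring, Real.sin_add, h4]
      at h3'
    rw [zero_mul, zero_add] at h3'
    exact mul_right_cancel₀ hs.ne' (h3'.trans (one_mul _).symm)
  obtain ⟨n, hn⟩ := (Real.cos_eq_one_iff _).1 h5
  rw [hθ] at hn
  have hm0 : (M s t : ℝ) ≠ 0 := by positivity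
  have : (k : ℝ) = M s t * n := by
    push_cast at hn
    field_simp at hn
    linarith
  have : (k : ℤ) = M s t * n := by exact_mod_cast this
  exact Int.natCast_dvd_natCast.1 ⟨n, this⟩

end Order

section

open CoxeterSystem List

/-! ### The exchange condition -/

section Exchange

variable {B : Type u} {M : CoxeterMatrix B} {W : Type v} [Group W] (cs : CoxeterSystem M W)

theorem rightInvSeq_append (ω ω' : List B) :
    cs.rightInvSeq (ω ++ ω') =
      (cs.rightInvSeq ω).map (fun t => (cs.wordProd ω')⁻¹ * t * cs.wordProd ω') ++
        cs.rightInvSeq ω' := by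
  induction ω with
  | nil => simp
  | cons i ω ih =>
    rw [cons_append, rightInvSeq, rightInvSeq, ih, map_cons, cons_append, wordProd_append]
    congr 1
    group

open scoped Classical in
/-- The signed conjugation of `W × ℤ/2` by a simple reflection `s`: conjugate the first coordinate
by `s`, and change the sign when it is `s`. -/
noncomputable def signedConj (i : B) : Function.End (W × ZMod 2) :=
  fun p => (cs.simple i * p.1 * cs.simple i, p.2 + if p.1 = cs.simple i then 1 else 0)

open scoped Classical in
theorem prod_map_signedConj_apply (ω : List B) (x : W) (ε : ZMod 2) :
    (ω.map (signedConj cs)).prod (x, ε) =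
      (cs.wordProd ω * x * (cs.wordProd ω)⁻¹, ε + (cs.rightInvSeq ω).count x) := by
  induction ω with
  | nil => simp [Function.End.one_def]
  | cons i ω ih =>
    rw [map_cons, prod_cons]
    change signedConj cs i ((ω.map (signedConj cs)).prod (x, ε)) = _
    rw [ih, signedConj, rightInvSeq, wordProd_cons, count_cons]
    ext1
    · simp [mul_assoc]
    · have : (cs.wordProd ω * x * (cs.wordProd ω)⁻¹ = cs.simple i) ↔
          ((cs.wordProd ω)⁻¹ * cs.simple i * cs.wordProd ω = x) := by
        constructor <;> rintro h
        · rw [← h]; group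
        · rw [← h]; group
      simp only [this, beq_iff_eq]
      push_cast
      ring

theorem rightInvSeq_alternatingWord (i j : B) (k : ℕ) :
    cs.rightInvSeq (alternatingWord i j k) =
      ((range k).map fun n => cs.simple j * (cs.simple i * cs.simple j) ^ n).reverse := by
  induction k generalizing i j with
  | zero => simp [alternatingWord]
  | succ k ih =>
    rw [alternatingWord_succ, rightInvSeq_concat, ih, range_succ_eq_map, map_cons, reverse_cons,
      map_reverse, map_map, map_map, concat_eq_append]
    congr 2
    · apply map_congr_left
      intro n _
      simp only [Function.comp_apply, MulAut.conj_apply, cs.inv_simple]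
      rw [← mul_pow_mul, Nat.succ_eq_add_one, pow_succ]
      simp only [mul_assoc]
    · simp

/-- The right inversion sequence of `(s t)^m`, `m = M s t`, runs twice through the same list, so
that every element occurs in it an even number of times. -/
theorem rightInvSeq_alternatingWord_two_mul (i j : B) :
    ∃ L, cs.rightInvSeq (alternatingWord i j (2 * M i j)) = L ++ L := by
  refine ⟨((range (M i j)).map fun n => cs.simple j * (cs.simple i * cs.simple j) ^ n).reverse, ?_⟩
  rw [rightInvSeq_alternatingWord, two_mul, range_add, map_append, reverse_append, map_map]
  congr 2
  apply map_congr_left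
  intro n _
  simp [pow_add]

theorem isLiftable_signedConj : M.IsLiftable (signedConj cs) := by
  classical
  intro i j
  have h : (signedConj cs i * signedConj cs j) ^ M i j =
      ((alternatingWord i j (2 * M i j)).map (signedConj cs)).prod := by
    generalize M i j = m
    induction m with
    | zero => simp [alternatingWord]
    | succ m ih =>
      rw [pow_succ, ih, show 2 * (m + 1) = 2 * m + 1 + 1 by ring, alternatingWord_succ,
        alternatingWord_succ]
      simp
  obtain ⟨L, hL⟩ := rightInvSeq_alternatingWord_two_mul cs i j
  have h1 : cs.wordProd (alternatingWord i j (2 * M i j)) = 1 := by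
    rw [prod_alternatingWord_eq_mul_pow]; simp
  rw [h]
  funext ⟨x, ε⟩
  rw [prod_map_signedConj_apply, hL, h1, count_append]
  change _ = (x, ε)
  push_cast
  rw [← two_mul, show (2 : ZMod 2) = 0 from rfl]
  simp

open scoped Classical in
theorem count_rightInvSeq_eq {ω ω' : List B} (h : cs.wordProd ω = cs.wordProd ω') (x : W) :
    ((cs.rightInvSeq ω).count x : ZMod 2) = (cs.rightInvSeq ω').count x := by
  have key : ∀ ω : List B, cs.lift ⟨_, isLiftable_signedConj cs⟩ (cs.wordProd ω) =
      (ω.map (signedConj cs)).prod := by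
    intro ω
    induction ω with
    | nil => simp
    | cons i ω ih => rw [wordProd_cons, map_mul, cs.lift_apply_simple, ih]; rfl
  have h1 := congrFun ((key ω).symm.trans ((congrArg _ h).trans (key ω'))) (x, 0)
  rw [prod_map_signedConj_apply, prod_map_signedConj_apply] at h1
  simpa using congrArg Prod.snd h1

/-- The exchange condition: a right descent of `π ω` occurs in the right inversion sequence of `ω`,
whether or not `ω` is reduced. -/
theorem mem_rightInvSeq_of_isRightDescent {ω : List B} {i : B}
    (h : cs.IsRightDescent (cs.wordProd ω) i) : cs.simple i ∈ cs.rightInvSeq ω := by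
  classical
  obtain ⟨ω', hr, hω'⟩ := cs.exists_isReduced (cs.wordProd ω * cs.simple i)
  have hω : cs.wordProd (ω' ++ [i]) = cs.wordProd ω := by
    rw [wordProd_append, ← hω']; simp
  have hred : cs.IsReduced (ω' ++ [i]) := by
    have h1 := (cs.isRightDescent_iff).1 h
    have h2 : cs.length (cs.wordProd ω') = ω'.length := hr
    unfold CoxeterSystem.IsReduced
    rw [hω, ← h1, hω', h2]; simp
  have hc : (cs.rightInvSeq (ω' ++ [i])).count (cs.simple i) = 1 := by
    apply count_eq_one_of_mem hred.nodup_rightInvSeq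
    rw [rightInvSeq_append]; simp
  have := count_rightInvSeq_eq cs hω (cs.simple i)
  rw [hc] at this
  by_contra hn
  rw [count_eq_zero_of_not_mem hn] at this
  exact absurd this (by decide)

/-- The exchange condition for a product `x · π ω`: the deleted letter lies in `ω` or in a reduced
word of `x`. In the second case the reflection moved across `π ω` shortens `x`. -/
theorem mem_rightInvSeq_or_exists_of_isRightDescent {x : W} {ω : List B} {i : B}
    (h : cs.IsRightDescent (x * cs.wordProd ω) i) :
    cs.simple i ∈ cs.rightInvSeq ω ∨
      cs.length (x * (cs.wordProd ω * cs.simple i * (cs.wordProd ω)⁻¹)) < cs.length x := by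
  obtain ⟨ω₀, hr, rfl⟩ := cs.exists_isReduced x
  rw [← wordProd_append] at h
  have h1 := mem_rightInvSeq_of_isRightDescent cs h
  rw [rightInvSeq_append, mem_append, mem_map] at h1
  rcases h1 with ⟨t, ht, hti⟩ | h1
  · right
    rw [← hti]
    have := (cs.isRightInversion_of_mem_rightInvSeq hr ht).2
    convert this using 2
    group
  · exact Or.inl h1

end Exchange

/-! ### Dihedral cosets -/

section Dihedral

variable {B : Type u} {M : CoxeterMatrix B} {W : Type v} [Group W] (cs : CoxeterSystem M W)

theorem wordProd_alternatingWord_succ (i j : B) (k : ℕ) :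
    cs.wordProd (alternatingWord i j (k + 1)) =
      cs.wordProd (alternatingWord j i k) * cs.simple j := by
  rw [alternatingWord_succ, wordProd_concat]

theorem simple_notMem_rightInvSeq_alternatingWord {i j : B} (hij : i ≠ j) {k : ℕ}
    (hk : M i j ≠ 0 → k < M i j) : cs.simple i ∉ cs.rightInvSeq (alternatingWord i j k) := by
  intro h
  rw [rightInvSeq_alternatingWord, mem_reverse, mem_map] at h
  obtain ⟨n, hn, h⟩ := h
  rw [mem_range] at hn
  have : (cs.simple i * cs.simple j) ^ (n + 1) = 1 := by
    rw [pow_succ', mul_assoc, h]; simp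
  have := dvd_of_simple_mul_simple_pow_eq_one cs hij this
  rcases eq_or_ne (M i j) 0 with h0 | h0
  · rw [h0] at this; simp at this
  · have := Nat.le_of_dvd (by omega) this
    have := hk h0
    omega

/-- The dihedral subgroup generated by two simple reflections. -/
def dihedral (i j : B) : Subgroup W := Subgroup.closure {cs.simple i, cs.simple j}

theorem simple_right_mem_dihedral (i j : B) : cs.simple j ∈ dihedral cs i j :=
  Subgroup.subset_closure (by simp)

theorem dihedral_comm (i j : B) : dihedral cs i j = dihedral cs j i := by
  rw [dihedral, dihedral, Set.pair_comm]

theorem wordProd_alternatingWord_mem_dihedral (i j : B) (k : ℕ) :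
    cs.wordProd (alternatingWord i j k) ∈ dihedral cs i j := by
  induction k generalizing i j with
  | zero => simp [alternatingWord, one_mem]
  | succ k ih =>
    rw [wordProd_alternatingWord_succ]
    exact mul_mem (dihedral_comm cs i j ▸ ih j i) (simple_right_mem_dihedral cs i j)

/-- `p` is an alternating product of `i` and `j` of length at most `M i j`, ending with either. -/
def IsAlternating (i j : B) (p : W) : Prop :=
  ∃ k, (M i j ≠ 0 → k ≤ M i j) ∧
    (p = cs.wordProd (alternatingWord i j k) ∨ p = cs.wordProd (alternatingWord j i k))

theorem IsAlternating.symm {i j : B} {p : W} (h : IsAlternating cs i j p) :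
    IsAlternating cs j i p := by
  obtain ⟨k, hk, h⟩ := h
  exact ⟨k, M.symmetric i j ▸ hk, h.symm⟩

theorem isAlternating_alternatingWord_mul {i j : B} {k : ℕ}
    (hk : M i j ≠ 0 → k ≤ M i j) : 
    IsAlternating cs i j (cs.wordProd (alternatingWord i j k) * cs.simple i) ∧
    IsAlternating cs i j (cs.wordProd (alternatingWord i j k) * cs.simple j) := by
  constructor
  · by_cases h : M i j ≠ 0 ∧ k = M i j
    · obtain ⟨h0, rfl⟩ := h
      obtain ⟨m, hm⟩ := Nat.exists_eq_succ_of_ne_zero h0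
      refine ⟨m, fun _ => by omega, Or.inl ?_⟩
      have := cs.wordProd_braidWord_eq i j
      rw [braidWord, braidWord, M.symmetric j i] at this
      rw [this, hm, Nat.succ_eq_add_one, wordProd_alternatingWord_succ]
      simp
    · refine ⟨k + 1, fun h0 => ?_, Or.inr (wordProd_alternatingWord_succ cs j i k).symm⟩
      have := hk h0
      have : k ≠ M i j := fun h' => h ⟨h0, h'⟩
      omega
  · rcases k with _ | k
    · refine ⟨1, fun h0 => by omega, Or.inl ?_⟩
      rw [wordProd_alternatingWord_succ]
      simp [alternatingWord]
    · refine ⟨k, fun h0 => by have := hk h0; omega, Or.inr ?_⟩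
      rw [wordProd_alternatingWord_succ]
      simp

theorem isAlternating_of_mem_dihedral {i j : B} {p : W} (hp : p ∈ dihedral cs i j) :
    IsAlternating cs i j p := by
  have key : ∀ p, IsAlternating cs i j p →
      IsAlternating cs i j (p * cs.simple i) ∧ IsAlternating cs i j (p * cs.simple j) := by
    rintro p ⟨k, hk, rfl | rfl⟩
    · exact isAlternating_alternatingWord_mul cs hk
    · have := isAlternating_alternatingWord_mul cs (M.symmetric i j ▸ hk)
      exact ⟨this.2.symm, this.1.symm⟩
  refine Subgroup.closure_induction_right (p := fun x _ => IsAlternating cs i j x)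
    ⟨0, fun _ => Nat.zero_le _, Or.inl (by simp [alternatingWord])⟩ ?_ ?_ hp
  · rintro x _ y (rfl | rfl) h
    exacts [(key x h).1, (key x h).2]
  · rintro x _ y (rfl | rfl) h <;> rw [cs.inv_simple]
    exacts [(key x h).1, (key x h).2]

/-- Lengths add along alternating words of length at most `M i j` to the right of a shortest element
of a coset of the dihedral subgroup. -/
theorem length_mul_alternatingWord_of_minimal {i j : B} (hij : i ≠ j) {y : W}
    (hy : ∀ p ∈ dihedral cs i j, cs.length y ≤ cs.length (y * p)) {k : ℕ}
    (hk : M i j ≠ 0 → k ≤ M i j) :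
    cs.length (y * cs.wordProd (alternatingWord i j k)) = cs.length y + k := by
  induction k generalizing i j with
  | zero => simp [alternatingWord]
  | succ k ih =>
    have ih' := ih hij.symm (dihedral_comm cs i j ▸ hy)
      (fun h => by rw [M.symmetric j i] at h ⊢; have := hk h; omega)
    rw [wordProd_alternatingWord_succ, ← mul_assoc]
    by_cases hd : cs.IsRightDescent (y * cs.wordProd (alternatingWord j i k)) j
    · rcases mem_rightInvSeq_or_exists_of_isRightDescent cs hd with h | h
      · exact absurd h (simple_notMem_rightInvSeq_alternatingWord cs hij.symm
          (fun h => by rw [M.symmetric j i] at h ⊢; have := hk h; omega))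
      · have hm := dihedral_comm cs i j ▸ wordProd_alternatingWord_mem_dihedral cs j i k
        have := hy _ (mul_mem (mul_mem hm (simple_right_mem_dihedral cs i j)) (inv_mem hm))
        omega
    · rw [(cs.not_isRightDescent_iff).1 hd, ih']
      ring

theorem exists_minimal_dihedral (i j : B) (z : W) :
    ∃ y, ∃ p ∈ dihedral cs i j, z = y * p ∧
      ∀ p ∈ dihedral cs i j, cs.length y ≤ cs.length (y * p) := by
  obtain ⟨q, hq, hmin⟩ := WellFounded.has_min
    (InvImage.wf (fun q => cs.length (z * q)) Nat.lt_wfRel.wf) (dihedral cs i j : Set W)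
    ⟨1, one_mem _⟩
  refine ⟨z * q, q⁻¹, inv_mem hq, by group, fun p hp => ?_⟩
  have := hmin (q * p) (mul_mem hq hp)
  simp only [InvImage, WellFoundedRelation.rel, not_lt] at this
  rw [mul_assoc]
  exact this

/-- An element without right descents `i`, `j` is the shortest one of its dihedral coset. -/
theorem length_mul_alternatingWord {i j : B} (hij : i ≠ j) {y : W}
    (hi : ¬ cs.IsRightDescent y i) (hj : ¬ cs.IsRightDescent y j) {k : ℕ}
    (hk : M i j ≠ 0 → k ≤ M i j) :
    cs.length (y * cs.wordProd (alternatingWord i j k)) = cs.length y + k := by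
  obtain ⟨u, p, hp, rfl, hu⟩ := exists_minimal_dihedral cs i j y
  have key : ∀ i j : B, i ≠ j →
      (∀ p ∈ dihedral cs i j, cs.length u ≤ cs.length (u * p)) → ∀ n, (M i j ≠ 0 → n ≤ M i j) →
      n ≠ 0 → cs.IsRightDescent (u * cs.wordProd (alternatingWord i j n)) j := by
    intro i j hij hu n hn hn0
    obtain ⟨n, rfl⟩ := Nat.exists_eq_succ_of_ne_zero hn0
    have h1 := length_mul_alternatingWord_of_minimal cs hij hu hn
    have h2 := length_mul_alternatingWord_of_minimal cs hij.symm (dihedral_comm cs i j ▸ hu)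
      (k := n) (fun h => by rw [M.symmetric j i] at h ⊢; have := hn h; omega)
    unfold IsRightDescent
    rw [h1, Nat.succ_eq_add_one, wordProd_alternatingWord_succ, ← mul_assoc,
      simple_mul_simple_cancel_right, h2]
    omega
  -- Otherwise `u * p` ends in `i` or `j`, with lengths adding, and has a right descent.
  have hp1 : p = 1 := by
    obtain ⟨n, hn, rfl | rfl⟩ := isAlternating_of_mem_dihedral cs hp
    · rcases eq_or_ne n 0 with rfl | hn0
      · simp [alternatingWord]
      · exact absurd (key i j hij hu n hn hn0) hj
    · rcases eq_or_ne n 0 with rfl | hn0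
      · simp [alternatingWord]
      · exact absurd (key j i hij.symm (dihedral_comm cs i j ▸ hu) n (M.symmetric i j ▸ hn) hn0) hi
  subst hp1
  rw [mul_one]
  exact length_mul_alternatingWord_of_minimal cs hij hu hk

/-- If `i ≠ j` are right descents of `z`, then `M i j` is finite and `z` ends, with lengths adding,
in the longest element of the dihedral subgroup. -/
theorem exists_eq_mul_braidWord {i j : B} (hij : i ≠ j) {z : W}
    (hi : cs.IsRightDescent z i) (hj : cs.IsRightDescent z j) :
    M i j ≠ 0 ∧ ∃ y, z = y * cs.wordProd (braidWord M i j) ∧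
      cs.length z = cs.length y + M i j := by
  obtain ⟨y, p, hp, rfl, hy⟩ := exists_minimal_dihedral cs i j z
  have key : ∀ i j : B, i ≠ j →
      (∀ p ∈ dihedral cs i j, cs.length y ≤ cs.length (y * p)) → ∀ n, (M i j ≠ 0 → n ≤ M i j) →
      cs.IsRightDescent (y * cs.wordProd (alternatingWord i j n)) i → M i j ≠ 0 ∧ n = M i j := by
    intro i j hij hy n hn hd
    by_contra hne
    have h1 := length_mul_alternatingWord_of_minimal cs hij hy hn
    have h2 := length_mul_alternatingWord_of_minimal cs hij.symm (dihedral_comm cs i j ▸ hy)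
      (k := n + 1) (fun h => by
        rw [M.symmetric j i] at h ⊢
        have := hn h
        have : n ≠ M i j := fun h' => hne ⟨h, h'⟩
        omega)
    unfold IsRightDescent at hd
    rw [mul_assoc, ← wordProd_alternatingWord_succ] at hd
    omega
  obtain ⟨n, hn, rfl | rfl⟩ := isAlternating_of_mem_dihedral cs hp
  · obtain ⟨h0, rfl⟩ := key i j hij hy n hn hi
    exact ⟨h0, y, rfl, length_mul_alternatingWord_of_minimal cs hij hy hn⟩
  · obtain ⟨h0, rfl⟩ := key j i hij.symm (dihedral_comm cs i j ▸ hy) n (M.symmetric i j ▸ hn) hj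
    refine ⟨M.symmetric i j ▸ h0, y, by rw [cs.wordProd_braidWord_eq], ?_⟩
    rw [M.symmetric i j]
    exact length_mul_alternatingWord_of_minimal cs hij.symm (dihedral_comm cs i j ▸ hy)
      (fun _ => le_rfl)

end Dihedral

/-! ### Words in the Artin monoid -/

section Words

variable {S : Type u} (M : CoxeterMatrix S)

/-- The element of the Artin monoid represented by a word in the generators. -/
def word (ω : List S) : ArtinMonoid M :=
  PresentedMonoid.mk (BraidRel M) (FreeMonoid.ofList ω)

@[simp] theorem word_nil : word M [] = 1 := rfl

theorem word_append (ω ω' : List S) : word M (ω ++ ω') = word M ω * word M ω' := rfl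

theorem word_singleton (s : S) : word M [s] = gen M s := rfl

theorem word_cons (s : S) (ω : List S) : word M (s :: ω) = gen M s * word M ω := rfl

theorem word_surjective : Function.Surjective (word M) := fun a => by
  obtain ⟨ω, rfl⟩ := PresentedMonoid.surjective_mk a
  exact ⟨ω.toList, rfl⟩

theorem word_alternatingWord_succ (s t : S) (k : ℕ) :
    word M (alternatingWord s t (k + 1)) = word M (alternatingWord t s k) * gen M t := by
  rw [alternatingWord_succ, concat_eq_append, word_append, word_singleton]

theorem word_braidWord_comm {s t : S} (hst : s ≠ t) (h : M s t ≠ 0) :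
    word M (braidWord M s t) = word M (braidWord M t s) :=
  PresentedMonoid.mk_eq_mk_of_rel (BraidRel.braid s t hst h)

variable {M}

theorem word_induction {p : ArtinMonoid M → Prop} (one : p 1)
    (mul_gen : ∀ a s, p a → p (a * gen M s)) (a : ArtinMonoid M) : p a := by
  obtain ⟨ω, rfl⟩ := word_surjective M a
  induction ω using reverseRecOn with
  | nil => exact one
  | append_singleton ω s ih => exact mul_gen _ _ ih

/-- The word length on the Artin monoid, as a homomorphism. -/
def lengthHom : ArtinMonoid M →* Multiplicative ℕ :=
  PresentedMonoid.lift (fun _ => Multiplicative.ofAdd 1) (by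
    have key : ∀ ω : List S, FreeMonoid.lift (fun _ : S => Multiplicative.ofAdd 1)
        (FreeMonoid.ofList ω) = Multiplicative.ofAdd ω.length := by
      intro ω
      simp [FreeMonoid.lift_apply, ← ofAdd_nsmul]
    rintro _ _ ⟨s, t, -, -⟩
    rw [key, key, length_alternatingWord, length_alternatingWord, M.symmetric])

/-- The word length on the Artin monoid. -/
def len (a : ArtinMonoid M) : ℕ := (lengthHom a).toAdd

@[simp] theorem len_one : len (1 : ArtinMonoid M) = 0 := by simp [len]

@[simp] theorem len_mul (a b : ArtinMonoid M) : len (a * b) = len a + len b := by simp [len]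

@[simp] theorem len_gen (s : S) : len (gen M s) = 1 := rfl

@[simp] theorem len_word (ω : List S) : len (word M ω) = ω.length := by
  induction ω with
  | nil => simp
  | cons s ω ih => rw [word_cons]; simp [ih, add_comm]

theorem len_eq_zero_iff {a : ArtinMonoid M} : len a = 0 ↔ a = 1 := by
  constructor
  · obtain ⟨ω, rfl⟩ := word_surjective M a
    intro h
    rw [len_word, length_eq_zero_iff] at h
    rw [h, word_nil]
  · rintro rfl; simp

theorem reverse_alternatingWord (s t : S) (k : ℕ) :
    (alternatingWord s t k).reverse =
      if Even k then alternatingWord t s k else alternatingWord s t k := by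
  induction k with
  | zero => simp [alternatingWord]
  | succ k ih =>
    conv_lhs => rw [alternatingWord_succ', reverse_cons, ih]
    rw [alternatingWord_succ, concat_eq_append, alternatingWord_succ, concat_eq_append]
    by_cases hk : Even k <;> simp [hk, Nat.even_add_one]

end Words

/-! ### Lifting the Coxeter group to the Artin monoid -/

section Lift

variable {S : Type u} {M : CoxeterMatrix S} {W : Type v} [Group W] (cs : CoxeterSystem M W)

theorem isReduced_of_append_singleton {ω : List S} {s : S} (h : cs.IsReduced (ω ++ [s])) :
    cs.IsReduced ω ∧ cs.IsRightDescent (cs.wordProd (ω ++ [s])) s := by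
  have h1 : cs.IsReduced ω := by simpa using h.take ω.length
  refine ⟨h1, ?_⟩
  unfold IsRightDescent
  rw [h.eq, wordProd_append, wordProd_singleton, simple_mul_simple_cancel_right, h1.eq]
  simp

/-- Matsumoto's theorem: reduced words of the same element of the Coxeter group represent the same
element of the Artin monoid. -/
theorem word_eq_word_of_isReduced {ω ω' : List S} (h : cs.IsReduced ω) (h' : cs.IsReduced ω')
    (he : cs.wordProd ω = cs.wordProd ω') : word M ω = word M ω' := by
  induction hn : ω.length generalizing ω ω' with
  | zero =>
    have : ω'.length = 0 := by rw [← h'.eq, ← he, h.eq, hn]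
    rw [length_eq_zero_iff] at hn this
    rw [hn, this]
  | succ n ih =>
    have hn' : ω'.length = n + 1 := by rw [← h'.eq, ← he, h.eq, hn]
    rcases eq_nil_or_concat ω with rfl | ⟨ω₁, s, rfl⟩
    · simp at hn
    rcases eq_nil_or_concat ω' with rfl | ⟨ω₁', t, rfl⟩
    · simp at hn'
    simp only [concat_eq_append] at h h' he hn hn' ⊢
    obtain ⟨hr, hd⟩ := isReduced_of_append_singleton cs h
    obtain ⟨hr', hd'⟩ := isReduced_of_append_singleton cs h'
    rw [length_append, length_singleton, Nat.add_right_cancel_iff] at hn hn'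
    rw [wordProd_append, wordProd_append] at he
    rcases eq_or_ne s t with rfl | hst
    · rw [word_append, word_append, ih hr hr' (mul_right_cancel he) hn]
    -- Both words are compared with words that end in the two braid words.
    have hlen := h.eq
    rw [wordProd_append, ← he, ← wordProd_append] at hd'
    obtain ⟨h0, y, hy, hly⟩ := exists_eq_mul_braidWord cs hst hd hd'
    obtain ⟨η, hη, rfl⟩ := cs.exists_isReduced y
    obtain ⟨k, hk⟩ := Nat.exists_eq_succ_of_ne_zero h0
    have hk' : M t s = k + 1 := by rw [M.symmetric t s, hk]
    have e2 : cs.wordProd ω₁' = cs.wordProd (η ++ alternatingWord t s k) := by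
      apply mul_right_cancel (b := cs.simple t)
      rw [wordProd_append _ η, mul_assoc, ← wordProd_alternatingWord_succ]
      rw [wordProd_append, he, wordProd_singleton] at hy
      rw [hy, braidWord, hk]
    have e1 : cs.wordProd ω₁ = cs.wordProd (η ++ alternatingWord s t k) := by
      apply mul_right_cancel (b := cs.simple s)
      rw [wordProd_append _ η, mul_assoc, ← wordProd_alternatingWord_succ]
      rw [wordProd_append, wordProd_singleton, wordProd_braidWord_eq] at hy
      rw [hy, braidWord, hk']
    rw [hlen, hη.eq, hk, length_append, length_singleton] at hly
    have l1 := hr.eq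
    have l2 := hr'.eq
    have r1 : cs.IsReduced (η ++ alternatingWord s t k) := by
      unfold CoxeterSystem.IsReduced
      rw [← e1, l1, length_append, length_alternatingWord]; omega
    have r2 : cs.IsReduced (η ++ alternatingWord t s k) := by
      unfold CoxeterSystem.IsReduced
      rw [← e2, l2, length_append, length_alternatingWord]; omega
    rw [word_append, word_append, ih hr r1 e1 hn, ih hr' r2 e2 hn', word_append, word_append,
      mul_assoc, mul_assoc, word_singleton, word_singleton, ← word_alternatingWord_succ,
      ← word_alternatingWord_succ]
    have := word_braidWord_comm M hst h0
    rw [braidWord, braidWord, hk, hk'] at this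
    rw [this]

/-- The canonical lift of the Coxeter group to the Artin monoid, through reduced words. -/
noncomputable def lift (w : W) : ArtinMonoid M :=
  word M (cs.exists_isReduced w).choose

theorem lift_wordProd {ω : List S} (h : cs.IsReduced ω) : lift cs (cs.wordProd ω) = word M ω :=
  word_eq_word_of_isReduced cs (cs.exists_isReduced _).choose_spec.1 h
    (cs.exists_isReduced _).choose_spec.2.symm

@[simp] theorem lift_one : lift cs 1 = 1 := by
  have : cs.IsReduced [] := by unfold CoxeterSystem.IsReduced; simp
  simpa using lift_wordProd cs this

theorem lift_mul {x y : W} (h : cs.length (x * y) = cs.length x + cs.length y) :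
    lift cs (x * y) = lift cs x * lift cs y := by
  obtain ⟨ω, hω, rfl⟩ := cs.exists_isReduced x
  obtain ⟨η, hη, rfl⟩ := cs.exists_isReduced y
  rw [lift_wordProd cs hω, lift_wordProd cs hη, ← wordProd_append, ← word_append]
  apply lift_wordProd
  unfold CoxeterSystem.IsReduced
  rw [wordProd_append, h, hω.eq, hη.eq, length_append]

@[simp] theorem lift_simple (s : S) : lift cs (cs.simple s) = gen M s := by
  have : cs.IsReduced [s] := by unfold CoxeterSystem.IsReduced; simp
  simpa [word_singleton] using lift_wordProd cs this

@[simp] theorem len_lift (w : W) : len (lift cs w) = cs.length w := by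
  obtain ⟨ω, hω, rfl⟩ := cs.exists_isReduced w
  rw [lift_wordProd cs hω, len_word, hω.eq]

theorem isReduced_alternatingWord {s t : S} (hst : s ≠ t) {k : ℕ} (hk : M s t ≠ 0 → k ≤ M s t) :
    cs.IsReduced (alternatingWord s t k) := by
  have := length_mul_alternatingWord cs hst (cs.not_isRightDescent_one s)
    (cs.not_isRightDescent_one t) hk
  unfold CoxeterSystem.IsReduced
  simpa using this

theorem length_alternatingWord_mul {s t : S} (hst : s ≠ t) {u : W}
    (hs : ¬ cs.IsLeftDescent u s) (ht : ¬ cs.IsLeftDescent u t) {k : ℕ}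
    (hk : M s t ≠ 0 → k ≤ M s t) :
    cs.length (cs.wordProd (alternatingWord s t k) * u) = k + cs.length u := by
  rw [← cs.length_inv, mul_inv_rev, ← wordProd_reverse, reverse_alternatingWord, add_comm,
    ← cs.length_inv u]
  rw [← cs.isRightDescent_inv_iff] at hs ht
  split_ifs
  · exact length_mul_alternatingWord cs hst.symm ht hs (M.symmetric s t ▸ hk)
  · exact length_mul_alternatingWord cs hst hs ht hk

end Lift

/-! ### Common left multiples of two generators -/

section CommonMultiple

variable {S : Type u} {M : CoxeterMatrix S} {W : Type v} [Group W] (cs : CoxeterSystem M W)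

/-- The expected relation between `(a, s)` and `(b, t)` when `a s = b t`: they agree, or `M s t` is
finite and both products factor through the least common left multiple of `s` and `t`. -/
def LcmRel (M : CoxeterMatrix S) (a : ArtinMonoid M) (s : S) (b : ArtinMonoid M) (t : S) : Prop :=
  (a = b ∧ s = t) ∨ (s ≠ t ∧ M s t ≠ 0 ∧ ∃ c, a = c * word M (alternatingWord s t (M s t - 1)) ∧
    b = c * word M (alternatingWord t s (M s t - 1)))

theorem LcmRel.symm {a b : ArtinMonoid M} {s t : S} (h : LcmRel M a s b t) : LcmRel M b t a s := by
  rcases h with ⟨rfl, rfl⟩ | ⟨hst, h0, c, rfl, rfl⟩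
  · exact Or.inl ⟨rfl, rfl⟩
  · exact Or.inr ⟨hst.symm, M.symmetric s t ▸ h0, c, M.symmetric s t ▸ rfl, M.symmetric s t ▸ rfl⟩

theorem LcmRel.mul_left {a b : ArtinMonoid M} {s t : S} (h : LcmRel M a s b t)
    (x : ArtinMonoid M) : LcmRel M (x * a) s (x * b) t := by
  rcases h with ⟨rfl, rfl⟩ | ⟨hst, h0, c, rfl, rfl⟩
  · exact Or.inl ⟨rfl, rfl⟩
  · exact Or.inr ⟨hst, h0, x * c, (mul_assoc _ _ _).symm, (mul_assoc _ _ _).symm⟩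

variable (M) in
/-- The lcm property for products of length at most `n`. -/
def LcmUpTo (n : ℕ) : Prop :=
  ∀ (a b : ArtinMonoid M) (s t : S), len a + 1 ≤ n → a * gen M s = b * gen M t → LcmRel M a s b t

theorem LcmUpTo.mul_right_cancel {n : ℕ} (hn : LcmUpTo M n) {a b x : ArtinMonoid M}
    (hx : len (a * x) ≤ n) (h : a * x = b * x) : a = b := by
  induction x using word_induction with
  | one => simpa using h
  | mul_gen x s ih =>
    rw [← mul_assoc, ← mul_assoc] at h
    rcases hn _ _ _ _ (by simpa [add_assoc] using hx) h with ⟨h1, -⟩ | ⟨h1, -⟩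
    · exact ih (by simp at hx ⊢; omega) h1
    · exact absurd rfl h1

/-- Newman's lemma: a terminating and locally confluent relation is confluent. -/
theorem newman {α : Type*} {r : α → α → Prop} (wf : WellFounded (flip r))
    (hr : ∀ a b c, r a b → r a c →
      ∃ d, Relation.ReflTransGen r b d ∧ Relation.ReflTransGen r c d) {a b c : α}
    (hb : Relation.ReflTransGen r a b) (hc : Relation.ReflTransGen r a c) :
    ∃ d, Relation.ReflTransGen r b d ∧ Relation.ReflTransGen r c d := by
  induction a using wf.induction generalizing b c with
  | _ a ih =>
    rcases hb.cases_head with rfl | ⟨b', hab', hb'⟩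
    · exact ⟨c, hc, .refl⟩
    rcases hc.cases_head with rfl | ⟨c', hac', hc'⟩
    · exact ⟨b, .refl, hb⟩
    obtain ⟨d, hbd, hcd⟩ := hr a b' c' hab' hac'
    obtain ⟨e, hbe, hde⟩ := ih b' hab' hb' hbd
    obtain ⟨f, hcf, hef⟩ := ih c' hac' hc' (hcd.trans hde)
    exact ⟨f, hbe.trans hef, hcf⟩

/-- `u` is a suffix of `v` in the Coxeter group: `v = x u` with lengths adding. -/
def IsSuffix (u v : W) : Prop := ∃ x, v = x * u ∧ cs.length v = cs.length x + cs.length u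

/-- If the lcm property holds up to `len d`, any two elements of the Coxeter group with property `G`
whose lifts divide `d` on the right are suffixes of a third one. Here `G` has to be inherited by
suffixes and compatible with least common left multiples of two generators. -/
theorem exists_isSuffix_isSuffix {n : ℕ} (hn : LcmUpTo M n) {d : ArtinMonoid M} (hd : len d ≤ n)
    (G : W → Prop) (hG : ∀ u s, ¬ cs.IsLeftDescent u s → G (cs.simple s * u) → G u)
    (hG' : ∀ u s t, s ≠ t → M s t ≠ 0 → ¬ cs.IsLeftDescent u s → ¬ cs.IsLeftDescent u t →
      G (cs.simple s * u) → G (cs.simple t * u) → G (cs.wordProd (braidWord M t s) * u))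
    {u₁ u₂ : W} (h₁ : G u₁ ∧ ∃ e, d = e * lift cs u₁) (h₂ : G u₂ ∧ ∃ e, d = e * lift cs u₂) :
    ∃ v, (G v ∧ ∃ e, d = e * lift cs v) ∧ IsSuffix cs u₁ v ∧ IsSuffix cs u₂ v := by
  -- `V` is the set of the elements in question; `r` appends one letter on the left.
  let V : W → Prop := fun u => G u ∧ ∃ e, d = e * lift cs u
  let r : W → W → Prop := fun u v => V v ∧ ∃ s, v = cs.simple s * u ∧
    cs.length v = cs.length u + 1
  have hlen : ∀ v, V v → cs.length v ≤ len d := by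
    rintro v ⟨-, e, rfl⟩; simp
  have wf : WellFounded (flip r) := by
    refine Subrelation.wf (r := InvImage (· < ·) fun u => len d - cs.length u) ?_
      (InvImage.wf _ Nat.lt_wfRel.wf)
    rintro v u ⟨hv, s, -, hs⟩
    have := hlen v hv
    simp only [InvImage]
    omega
  -- `V` is closed under suffixes, and each suffix is connected to the element by a chain in `V`.
  have suffix : ∀ x u, V (x * u) → cs.length (x * u) = cs.length x + cs.length u →
      V u ∧ Relation.ReflTransGen r u (x * u) := by
    intro x
    induction hx : cs.length x generalizing x with
    | zero =>
      rw [cs.length_eq_zero_iff] at hx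
      subst hx
      intro u hu _
      rw [one_mul] at hu ⊢
      exact ⟨hu, .refl⟩
    | succ k ih =>
      intro u hu hl
      have hx1 : x ≠ 1 := by rintro rfl; simp at hx
      obtain ⟨s, hs⟩ := cs.exists_leftDescent_of_ne_one hx1
      have hs' := (cs.isLeftDescent_iff).1 hs
      have hsx : cs.length (cs.simple s * x) = k := by omega
      have e : x * u = cs.simple s * (cs.simple s * x * u) := by simp [mul_assoc]
      have b1 := cs.length_mul_le (cs.simple s * x) u
      have b2 := cs.length_mul_le (cs.simple s) (cs.simple s * x * u)
      rw [← e, cs.length_simple] at b2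
      have hl' : cs.length (cs.simple s * x * u) = k + cs.length u := by omega
      have hnd : ¬ cs.IsLeftDescent (cs.simple s * x * u) s := by
        rw [cs.not_isLeftDescent_iff, ← e]; omega
      have hV : V (cs.simple s * x * u) := by
        obtain ⟨hg, f, hf⟩ := hu
        refine ⟨hG _ s hnd (e ▸ hg), f * gen M s, ?_⟩
        rw [e, lift_mul cs (by rw [← e, cs.length_simple]; omega), lift_simple] at hf
        rw [hf, mul_assoc f]
      obtain ⟨hVu, hru⟩ := ih _ hsx u hV hl'
      exact ⟨hVu, hru.tail ⟨hu, s, e, by omega⟩⟩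
  have hsuff : ∀ u v, Relation.ReflTransGen r u v → IsSuffix cs u v := by
    intro u v h
    induction h with
    | refl => exact ⟨1, by simp, by simp⟩
    | tail _ h ih =>
      obtain ⟨x, rfl, hx⟩ := ih
      obtain ⟨-, s, rfl, hs⟩ := h
      refine ⟨cs.simple s * x, by simp [mul_assoc], ?_⟩
      have b1 := cs.length_mul_le (cs.simple s * x) u
      have b2 := cs.length_mul_le (cs.simple s) x
      rw [cs.length_simple] at b2
      rw [mul_assoc] at b1
      omega
  -- Two one-letter extensions of `u` in `V` are suffixes of their least common left multiple,
  -- which lies in `V` by the lcm property.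
  have local_confl : ∀ a b c, r a b → r a c →
      ∃ d, Relation.ReflTransGen r b d ∧ Relation.ReflTransGen r c d := by
    rintro u _ _ ⟨⟨hgs, e₁, he₁⟩, s, rfl, hs⟩ ⟨⟨hgt, e₂, he₂⟩, t, rfl, ht⟩
    rcases eq_or_ne s t with rfl | hst
    · exact ⟨_, .refl, .refl⟩
    rw [lift_mul cs (by rw [hs, cs.length_simple, add_comm]), lift_simple] at he₁
    rw [lift_mul cs (by rw [ht, cs.length_simple, add_comm]), lift_simple] at he₂
    have hc : e₁ * gen M s = e₂ * gen M t := by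
      apply hn.mul_right_cancel (x := lift cs u)
      · rw [mul_assoc, ← he₁]; exact hd
      · rw [mul_assoc, mul_assoc, ← he₁, ← he₂]
    have hle : len e₁ + 1 ≤ n := by rw [he₁] at hd; simp at hd; omega
    rcases hn _ _ _ _ hle hc with ⟨-, h⟩ | ⟨-, h0, c, rfl, rfl⟩
    · exact absurd h hst
    obtain ⟨k, hk⟩ := Nat.exists_eq_succ_of_ne_zero h0
    have hk' : M t s = k + 1 := by rw [M.symmetric t s, hk]
    have hns : ¬ cs.IsLeftDescent u s := by rw [cs.not_isLeftDescent_iff, hs]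
    have hnt : ¬ cs.IsLeftDescent u t := by rw [cs.not_isLeftDescent_iff, ht]
    have hlz := length_alternatingWord_mul cs hst.symm hnt hns (k := M t s) fun _ => le_rfl
    have e1 : cs.wordProd (braidWord M t s) * u =
        cs.wordProd (alternatingWord s t k) * (cs.simple s * u) := by
      rw [braidWord, hk', wordProd_alternatingWord_succ, mul_assoc]
    have e2 : cs.wordProd (braidWord M t s) * u =
        cs.wordProd (alternatingWord t s k) * (cs.simple t * u) := by
      rw [wordProd_braidWord_eq, braidWord, hk, wordProd_alternatingWord_succ, mul_assoc]
    have l1 := (isReduced_alternatingWord cs hst (k := k) fun _ => by omega).eq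
    have l2 := (isReduced_alternatingWord cs hst.symm (k := k) fun _ => by omega).eq
    rw [length_alternatingWord] at l1 l2
    have hV : V (cs.wordProd (braidWord M t s) * u) := by
      refine ⟨hG' u s t hst h0 hns hnt hgs hgt, c, ?_⟩
      have hr := isReduced_alternatingWord cs hst.symm (k := M t s) fun _ => le_rfl
      rw [lift_mul cs (by rw [hlz, hr.eq, length_alternatingWord]), lift_wordProd cs hr, hk',
        word_alternatingWord_succ, he₁, hk]
      simp [mul_assoc]
    refine ⟨cs.wordProd (braidWord M t s) * u, ?_, ?_⟩
    · rw [e1] at hV ⊢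
      exact (suffix _ _ hV (by rw [← e1, hlz, l1, hs, hk']; ring)).2
    · rw [e2] at hV ⊢
      exact (suffix _ _ hV (by rw [← e2, hlz, l2, ht, hk']; ring)).2
  have from_one : ∀ u, V u → Relation.ReflTransGen r 1 u := by
    intro u hu
    have := (suffix u 1 (by rwa [mul_one]) (by simp)).2
    rwa [mul_one] at this
  obtain ⟨v, hv₁, hv₂⟩ := newman wf local_confl (from_one u₁ h₁) (from_one u₂ h₂)
  refine ⟨v, ?_, hsuff _ _ hv₁, hsuff _ _ hv₂⟩
  rcases hv₁.cases_tail with rfl | ⟨_, -, h⟩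
  exacts [h₁, h.1]

end CommonMultiple

section Lcm

variable {S : Type u} {M : CoxeterMatrix S} {W : Type v} [Group W] (cs : CoxeterSystem M W)

/-- Let `d = c (⋯ s r s)`, with a word one letter short of the braid word of `s` and `r`, and let `v`
extend this word to a longer divisor of `d` to which `r` can still be appended. Then `v r` ends in
`s`, and `c (⋯ r s r)` is the lift of `v r s`, multiplied by the rest of `d`. -/
theorem mul_word_eq_mul_lift {n : ℕ} (hn : LcmUpTo M n) {s r : S} (hsr : s ≠ r) (h0 : M s r ≠ 0)
    {c e d : ArtinMonoid M} (hd : len d ≤ n) {v : W}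
    (hc : d = c * word M (alternatingWord r s (M s r - 1))) (he : d = e * lift cs v)
    (hs : IsSuffix cs (cs.wordProd (alternatingWord r s (M s r - 1))) v)
    (hv : ¬ cs.IsRightDescent v r) :
    cs.IsRightDescent (v * cs.simple r) s ∧
      c * word M (alternatingWord s r (M s r - 1)) =
        e * lift cs (v * cs.simple r * cs.simple s) := by
  obtain ⟨k, hk⟩ := Nat.exists_eq_succ_of_ne_zero h0
  have hk' : M r s = k + 1 := by rw [M.symmetric r s, hk]
  have hsub : M s r - 1 = k := by omega
  rw [hsub] at hc hs ⊢
  rw [cs.not_isRightDescent_iff] at hv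
  obtain ⟨x, rfl, hx⟩ := hs
  have r1 := isReduced_alternatingWord cs hsr (k := k) fun _ => by omega
  have r2 := isReduced_alternatingWord cs hsr.symm (k := k) fun _ => by omega
  rw [r2.eq, length_alternatingWord] at hx
  have e1 : x * cs.wordProd (alternatingWord r s k) * cs.simple r * cs.simple s =
      x * cs.wordProd (alternatingWord s r k) := by
    have := cs.wordProd_braidWord_eq s r
    rw [braidWord, braidWord, hk, hk', Nat.succ_eq_add_one, wordProd_alternatingWord_succ,
      wordProd_alternatingWord_succ] at this
    rw [mul_assoc x, this]
    simp [mul_assoc]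
  have b1 := cs.length_mul_le x (cs.wordProd (alternatingWord s r k))
  rw [r1.eq, length_alternatingWord] at b1
  have hdesc : cs.IsRightDescent (x * cs.wordProd (alternatingWord r s k) * cs.simple r) s := by
    unfold IsRightDescent
    rw [e1]; omega
  refine ⟨hdesc, ?_⟩
  have h1 := (cs.isRightDescent_iff).1 hdesc
  rw [e1] at h1 ⊢
  rw [lift_mul cs (by rw [r2.eq, length_alternatingWord, hx]), lift_wordProd cs r2,
    ← mul_assoc] at he
  have : c = e * lift cs x := by
    apply hn.mul_right_cancel (x := word M (alternatingWord r s k))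
    · rw [← hc]; exact hd
    · rw [← hc, he]
  rw [lift_mul cs (by rw [r1.eq, length_alternatingWord]; omega), lift_wordProd cs r1, this,
    mul_assoc]

theorem lift_mul_simple_of_eq_mul_braidWord {s t : S} (hst : s ≠ t) (h0 : M s t ≠ 0) {y z : W}
    (hz : z = y * cs.wordProd (braidWord M s t)) (hl : cs.length z = cs.length y + M s t)
    (hs : cs.IsRightDescent z s) :
    lift cs (z * cs.simple s) = lift cs y * word M (alternatingWord s t (M s t - 1)) := by
  obtain ⟨k, hk⟩ := Nat.exists_eq_succ_of_ne_zero h0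
  have hk' : M t s = k + 1 := by rw [M.symmetric t s, hk]
  have r1 := isReduced_alternatingWord cs hst (k := k) fun _ => by omega
  have e : z * cs.simple s = y * cs.wordProd (alternatingWord s t k) := by
    rw [hz, wordProd_braidWord_eq, braidWord, hk', wordProd_alternatingWord_succ]
    simp [mul_assoc]
  have h1 := (cs.isRightDescent_iff).1 hs
  rw [e] at h1 ⊢
  rw [hk, Nat.succ_eq_add_one, Nat.add_sub_cancel, lift_mul cs (by
    rw [r1.eq, length_alternatingWord]; omega), lift_wordProd cs r1]

/-- The inductive step of the lcm property. For three different generators, a suffix `v` of `d` is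
found that extends the factorizations for `s` and `t` and to which `r` can be appended; then `v r`
has the right descents `s` and `t`, hence ends in their braid word. -/
theorem LcmRel.trans (cs : CoxeterSystem M W) {n : ℕ} (hn : LcmUpTo M n)
    {a b d : ArtinMonoid M} {s r t : S}
    (hd : len d ≤ n) (h₁ : LcmRel M a s d r) (h₂ : LcmRel M d r b t) : LcmRel M a s b t := by
  have h₂' := h₂.symm
  rcases h₁ with ⟨rfl, rfl⟩ | ⟨hsr, h0, c, rfl, hc⟩
  · exact h₂
  rcases h₂' with ⟨rfl, rfl⟩ | ⟨htr, h0', c', rfl, hc'⟩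
  · exact Or.inr ⟨hsr, h0, c, rfl, hc⟩
  rcases eq_or_ne s t with rfl | hst
  · refine Or.inl ⟨?_, rfl⟩
    have : c = c' := hn.mul_right_cancel (hc ▸ hd) (hc.symm.trans hc')
    rw [this]
  -- `r` can be appended to the two words that `d` is known to end in.
  have notDescent : ∀ s, s ≠ r → M s r ≠ 0 →
      ¬ cs.IsRightDescent (cs.wordProd (alternatingWord r s (M s r - 1))) r := by
    intro s hsr h0
    rw [cs.not_isRightDescent_iff, ← wordProd_alternatingWord_succ,
      (isReduced_alternatingWord cs hsr fun _ => by omega).eq,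
      (isReduced_alternatingWord cs hsr.symm fun _ => by rw [M.symmetric r s]; omega).eq,
      length_alternatingWord, length_alternatingWord]
  have lift_eq : ∀ s, s ≠ r → lift cs (cs.wordProd (alternatingWord r s (M s r - 1))) =
      word M (alternatingWord r s (M s r - 1)) := fun s hsr => lift_wordProd cs
    (isReduced_alternatingWord cs hsr.symm fun _ => by rw [M.symmetric r s]; omega)
  obtain ⟨v, ⟨hv, e, he⟩, hs₁, hs₂⟩ := exists_isSuffix_isSuffix cs hn hd
    (fun v => ¬ cs.IsRightDescent v r) (u₁ := cs.wordProd (alternatingWord r s (M s r - 1)))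
    (u₂ := cs.wordProd (alternatingWord r t (M t r - 1)))
    (by
      intro u i hi hiu
      rw [cs.not_isLeftDescent_iff] at hi
      rw [cs.not_isRightDescent_iff, mul_assoc] at hiu
      unfold IsRightDescent
      have := cs.length_mul_le (cs.simple i) (u * cs.simple r)
      rw [cs.length_simple] at this
      omega)
    (by
      intro u i j hij _ hi hj hiu hju
      have l1 := length_alternatingWord_mul cs hij.symm hj hi (k := M j i) fun _ => le_rfl
      rw [cs.not_isLeftDescent_iff] at hi hj
      rw [cs.not_isRightDescent_iff, mul_assoc] at hiu hju ⊢
      have b1 := cs.length_mul_le u (cs.simple r)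
      rw [cs.length_simple] at b1
      have b2 := cs.length_mul_le (cs.simple i) (u * cs.simple r)
      rw [cs.length_simple] at b2
      have l2 := length_alternatingWord_mul cs hij.symm (u := u * cs.simple r)
        (by rw [cs.not_isLeftDescent_iff]; omega) (by rw [cs.not_isLeftDescent_iff]; omega)
        (k := M j i) fun _ => le_rfl
      rw [braidWord, l1, l2]
      omega)
    ⟨notDescent s hsr h0, c, by rw [lift_eq s hsr, hc]⟩
    ⟨notDescent t htr h0', c', by rw [lift_eq t htr, hc']⟩
  obtain ⟨ds, es⟩ := mul_word_eq_mul_lift cs hn hsr h0 hd hc he hs₁ hv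
  obtain ⟨dt, et⟩ := mul_word_eq_mul_lift cs hn htr h0' hd hc' he hs₂ hv
  obtain ⟨hm, y, hz, hl⟩ := exists_eq_mul_braidWord cs hst ds dt
  refine Or.inr ⟨hst, hm, e * lift cs y, ?_, ?_⟩
  · rw [es, lift_mul_simple_of_eq_mul_braidWord cs hst hm hz hl ds, mul_assoc]
  · rw [et, lift_mul_simple_of_eq_mul_braidWord cs hst.symm (M.symmetric s t ▸ hm)
      (by rw [hz, wordProd_braidWord_eq]) (by rw [hl, M.symmetric s t]) dt, mul_assoc,
      M.symmetric t s]

variable (M) in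
/-- By induction on the length: words with equal values whose last letters are related by `LcmRel`
form a congruence that contains the braid relations. -/
theorem lcmUpTo (n : ℕ) : LcmUpTo M n := by
  induction n with
  | zero => intro a b s t h; omega
  | succ n ih =>
    let c : Con (FreeMonoid S) :=
      { r := fun w w' => word M w.toList = word M w'.toList ∧ ∀ x s y t, len (word M x) ≤ n →
          w.toList = x ++ [s] → w'.toList = y ++ [t] → LcmRel M (word M x) s (word M y) t
        iseqv := by
          refine ⟨fun w => ⟨rfl, ?_⟩, fun {w w'} h => ⟨h.1.symm, ?_⟩,
            fun {w w' w''} h h' => ⟨h.1.trans h'.1, ?_⟩⟩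
          · intro x s y t _ hx hy
            obtain ⟨rfl, h⟩ := append_inj' (hx.symm.trans hy) rfl
            exact Or.inl ⟨rfl, by simpa using h⟩
          · intro x s y t hl hx hy
            refine (h.2 y t x s ?_ hy hx).symm
            have := congrArg len h.1
            rw [hx, hy] at this
            simp at this hl ⊢
            omega
          · intro x s y t hl hx hy
            have hlen := congrArg len h.1
            rcases eq_nil_or_concat w'.toList with hw | ⟨z, r, hw⟩
            · rw [hx, hw] at hlen; simp at hlen
            rw [concat_eq_append] at hw
            rw [hx, hw] at hlen
            have hz : len (word M z) ≤ n := by simp at hlen hl ⊢; omega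
            exact LcmRel.trans M.toCoxeterSystem ih hz (h.2 x s z r hl hx hw)
              (h'.2 z r y t hz hw hy)
        mul' := by
          rintro w w' v v' ⟨h1, h2⟩ ⟨h3, h4⟩
          have e : word M (w * v).toList = word M (w' * v').toList := by
            rw [FreeMonoid.toList_mul, FreeMonoid.toList_mul, word_append, word_append, h1, h3]
          refine ⟨e, ?_⟩
          intro x s y t hl hx hy
          rw [FreeMonoid.toList_mul] at hx hy
          have hlen := congrArg len h3
          rw [len_word, len_word] at hlen
          rcases eq_nil_or_concat v.toList with hv | ⟨p, i, hv⟩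
          · rw [hv, length_nil] at hlen
            have hv' := length_eq_zero_iff.1 hlen.symm
            rw [hv, append_nil] at hx
            rw [hv', append_nil] at hy
            exact h2 x s y t hl hx hy
          · rcases eq_nil_or_concat v'.toList with hv' | ⟨q, j, hv'⟩
            · rw [hv, hv'] at hlen; simp at hlen
            rw [concat_eq_append] at hv hv'
            rw [hv, ← append_assoc] at hx
            rw [hv', ← append_assoc] at hy
            obtain ⟨rfl, hi⟩ := append_inj' hx rfl
            obtain ⟨rfl, hj⟩ := append_inj' hy rfl
            obtain rfl : i = s := by simpa using hi
            obtain rfl : j = t := by simpa using hj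
            rw [word_append, word_append, ← h1]
            refine (h4 p i q j ?_ hv hv').mul_left _
            rw [word_append, len_mul] at hl
            omega }
    have hle : conGen (BraidRel M) ≤ c := by
      rw [Con.conGen_le]
      rintro _ _ ⟨s, t, hst, h0⟩
      refine ⟨word_braidWord_comm M hst h0, ?_⟩
      intro x i y j _ hx hy
      rw [FreeMonoid.toList_ofList] at hx hy
      obtain ⟨k, hk⟩ := Nat.exists_eq_succ_of_ne_zero h0
      have hk' : M t s = k + 1 := by rw [M.symmetric t s, hk]
      rw [braidWord, hk, Nat.succ_eq_add_one, alternatingWord_succ, concat_eq_append] at hx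
      rw [braidWord, hk', alternatingWord_succ, concat_eq_append] at hy
      obtain ⟨rfl, hi⟩ := append_inj' hx rfl
      obtain ⟨rfl, hj⟩ := append_inj' hy rfl
      obtain rfl : t = i := by simpa using hi
      obtain rfl : s = j := by simpa using hj
      refine Or.inr ⟨hst.symm, by omega, 1, ?_, ?_⟩ <;> rw [one_mul, hk', Nat.add_sub_cancel]
    intro a b s t hl h
    obtain ⟨x, rfl⟩ := word_surjective M a
    obtain ⟨y, rfl⟩ := word_surjective M b
    have h' : word M (x ++ [s]) = word M (y ++ [t]) := h
    exact (hle (PresentedMonoid.mk_eq_mk_iff.1 h')).2 x s y t (by omega) rfl rfl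

theorem lcmRel_of_mul_gen_eq {a b : ArtinMonoid M} {s t : S} (h : a * gen M s = b * gen M t) :
    LcmRel M a s b t :=
  lcmUpTo M _ a b s t le_rfl h

instance isRightCancelMul : IsRightCancelMul (ArtinMonoid M) where
  mul_right_cancel x _ _ h := (lcmUpTo M _).mul_right_cancel (x := x) le_rfl h

/-- The anti-automorphism of the Artin monoid that reverses words. -/
def reverseHom : ArtinMonoid M →* (ArtinMonoid M)ᵐᵒᵖ :=
  PresentedMonoid.lift (fun s => MulOpposite.op (gen M s)) (by
    have key : ∀ ω : List S, FreeMonoid.lift (fun s => MulOpposite.op (gen M s))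
        (FreeMonoid.ofList ω) = MulOpposite.op (word M ω.reverse) := by
      intro ω
      induction ω with
      | nil => rfl
      | cons s ω ih =>
        rw [FreeMonoid.ofList_cons, map_mul, ih, FreeMonoid.lift_eval_of, reverse_cons, word_append,
          word_singleton, MulOpposite.op_mul]
    rintro _ _ ⟨s, t, hst, h0⟩
    rw [key, key, reverse_alternatingWord, reverse_alternatingWord, M.symmetric t s]
    have := word_braidWord_comm M hst h0
    rw [braidWord, braidWord, M.symmetric t s] at this
    split_ifs
    · rw [this]
    · rw [this])

theorem unop_reverseHom_unop_reverseHom (a : ArtinMonoid M) :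
    (reverseHom (reverseHom a).unop).unop = a := by
  induction a using word_induction with
  | one => simp
  | mul_gen a s ih =>
    have : ∀ s : S, (reverseHom (gen M s)).unop = gen M s := fun _ => rfl
    rw [map_mul, MulOpposite.unop_mul, map_mul, MulOpposite.unop_mul, ih, this, this]

instance isLeftCancelMul : IsLeftCancelMul (ArtinMonoid M) where
  mul_left_cancel x a b h := by
    have h' := congrArg (fun y => (reverseHom y).unop) h
    simp only [map_mul, MulOpposite.unop_mul] at h'
    have := congrArg (fun y => (reverseHom y).unop) (mul_right_cancel h')
    simpa [unop_reverseHom_unop_reverseHom] using this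

end Lcm

/-! ### Full subgraphs and spherical sets -/

section Subgraph

variable {S S' : Type*} {M : CoxeterMatrix S} {M' : CoxeterMatrix S'}

theorem mem_alternatingWord_iff {s t x : S} (k : ℕ) :
    x ∈ alternatingWord s t (k + 2) ↔ x = s ∨ x = t := by
  induction k generalizing s t with
  | zero => simp [alternatingWord]
  | succ k ih =>
    rw [alternatingWord_succ, concat_eq_append, mem_append, ih, mem_singleton]
    tauto

theorem mem_braidWord_iff {s t x : S} (hst : s ≠ t) (h0 : M s t ≠ 0) :
    x ∈ braidWord M s t ↔ x = s ∨ x = t := by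
  have h1 := M.off_diagonal s t hst
  obtain ⟨k, hk⟩ := Nat.exists_eq_add_of_le (show 2 ≤ M s t by omega)
  rw [braidWord, hk, add_comm, mem_alternatingWord_iff]

theorem map_alternatingWord (f : S' → S) (i j : S') (k : ℕ) :
    (alternatingWord i j k).map f = alternatingWord (f i) (f j) k := by
  induction k generalizing i j with
  | zero => rfl
  | succ k ih => rw [alternatingWord_succ, alternatingWord_succ, ← ih]; simp

/-- A word representing the same element as a word in the letters of a full subgraph is itself such
a word, and the two already represent the same element of the Artin monoid of the subgraph. -/
theorem exists_map_eq_of_word_eq {f : S' → S} (hf : Function.Injective f)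
    (hM : ∀ i j, M' i j = M (f i) (f j)) {ω' : List S'} {η : List S}
    (h : word M (ω'.map f) = word M η) :
    ∃ η' : List S', η = η'.map f ∧ word M' ω' = word M' η' := by
  let P : FreeMonoid S → FreeMonoid S → Prop := fun w w' =>
    ∀ ω' : List S', w.toList = ω'.map f →
      ∃ η' : List S', w'.toList = η'.map f ∧ word M' ω' = word M' η'
  have trans : ∀ {w w' w''}, P w w' → P w' w'' → P w w'' := by
    intro w w' w'' h h' ω' hω'
    obtain ⟨η', hη', e⟩ := h ω' hω'
    obtain ⟨ζ', hζ', e'⟩ := h' η' hη'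
    exact ⟨ζ', hζ', e.trans e'⟩
  have mul : ∀ {w w' v v'}, P w w' → P v v' → P (w * v) (w' * v') := by
    intro w w' v v' h h' ω' hω'
    rw [FreeMonoid.toList_mul] at hω'
    obtain ⟨ω₁, ω₂, rfl, h₁, h₂⟩ := map_eq_append_iff.1 hω'.symm
    obtain ⟨η₁, hη₁, e₁⟩ := h ω₁ h₁.symm
    obtain ⟨η₂, hη₂, e₂⟩ := h' ω₂ h₂.symm
    refine ⟨η₁ ++ η₂, ?_, ?_⟩
    · rw [FreeMonoid.toList_mul, hη₁, hη₂, map_append]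
    · rw [word_append, word_append, e₁, e₂]
  let c : Con (FreeMonoid S) :=
    { r := fun w w' => P w w' ∧ P w' w
      iseqv := ⟨fun w => ⟨fun ω' h => ⟨ω', h, rfl⟩, fun ω' h => ⟨ω', h, rfl⟩⟩,
        fun h => ⟨h.2, h.1⟩, fun h h' => ⟨trans h.1 h'.1, trans h'.2 h.2⟩⟩
      mul' := fun h h' => ⟨mul h.1 h'.1, mul h.2 h'.2⟩ }
  have braid : ∀ s t, s ≠ t → M s t ≠ 0 → P (FreeMonoid.ofList (braidWord M s t))
      (FreeMonoid.ofList (braidWord M t s)) := by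
    intro s t hst h0 ω' hω'
    rw [FreeMonoid.toList_ofList] at hω'
    have hs := (mem_braidWord_iff (x := s) hst h0).2 (Or.inl rfl)
    have ht := (mem_braidWord_iff (x := t) hst h0).2 (Or.inr rfl)
    rw [hω'] at hs ht
    obtain ⟨i, -, rfl⟩ := mem_map.1 hs
    obtain ⟨j, -, rfl⟩ := mem_map.1 ht
    rw [braidWord, ← hM, ← map_alternatingWord] at hω'
    obtain rfl := (map_injective_iff.2 hf) hω'
    refine ⟨braidWord M' j i, ?_, word_braidWord_comm M' (fun h => hst (h ▸ rfl)) (by rwa [hM])⟩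
    rw [FreeMonoid.toList_ofList, map_alternatingWord, hM]
  have hle : conGen (BraidRel M) ≤ c := by
    rw [Con.conGen_le]
    rintro _ _ ⟨s, t, hst, h0⟩
    exact ⟨braid s t hst h0, braid t s hst.symm (M.symmetric s t ▸ h0)⟩
  exact (hle (PresentedMonoid.mk_eq_mk_iff.1 h)).1 ω' rfl

theorem wordProd_eq_of_word_eq {W : Type*} [Group W] (cs : CoxeterSystem M W) {ω η : List S}
    (h : word M ω = word M η) : cs.wordProd ω = cs.wordProd η := by
  have key : ∀ ω : List S, FreeMonoid.lift cs.simple (FreeMonoid.ofList ω) = cs.wordProd ω := by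
    intro ω
    rw [FreeMonoid.lift_apply, FreeMonoid.toList_ofList, wordProd]
  have hrel : ∀ a b, BraidRel M a b → FreeMonoid.lift cs.simple a =
      FreeMonoid.lift cs.simple b := by
    rintro _ _ ⟨s, t, -, -⟩
    rw [key, key, wordProd_braidWord_eq]
  rw [← key, ← key]
  exact congrArg (PresentedMonoid.lift cs.simple hrel) h

variable {W W' : Type*} [Group W] [Group W'] (cs : CoxeterSystem M W) (cs' : CoxeterSystem M' W')

/-- Reduced words of a full subgraph stay reduced: if a letter could be exchanged in the whole graph,
Matsumoto's theorem would turn the word into one ending in this letter by braid relations, all of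
which take place in the subgraph. -/
theorem isReduced_map {f : S' → S} (hf : Function.Injective f)
    (hM : ∀ i j, M' i j = M (f i) (f j)) {ω : List S'} (h : cs'.IsReduced ω) :
    cs.IsReduced (ω.map f) := by
  induction ω using reverseRecOn with
  | nil => unfold CoxeterSystem.IsReduced; simp
  | append_singleton ω i ih =>
    have hω := ih (isReduced_of_append_singleton cs' h).1
    by_contra hn
    have hd : cs.IsRightDescent (cs.wordProd (ω.map f)) (f i) := by
      by_contra hnd
      apply hn
      rw [cs.not_isRightDescent_iff, hω.eq] at hnd
      unfold CoxeterSystem.IsReduced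
      rw [map_append, wordProd_append, map_singleton, wordProd_singleton, hnd]
      simp
    obtain ⟨η, hη, hηe⟩ := cs.exists_isReduced (cs.wordProd (ω.map f) * cs.simple (f i))
    have e : cs.wordProd (ω.map f) = cs.wordProd (η ++ [f i]) := by
      rw [wordProd_append, ← hηe]; simp
    have hr : cs.IsReduced (η ++ [f i]) := by
      have h1 := (cs.isRightDescent_iff).1 hd
      unfold CoxeterSystem.IsReduced
      rw [← e, ← h1, hηe, hη.eq]; simp
    obtain ⟨η', hη', he⟩ := exists_map_eq_of_word_eq hf hM (word_eq_word_of_isReduced cs hω hr e)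
    obtain ⟨η₁, η₂, rfl, h₁, h₂⟩ := map_eq_append_iff.1 hη'.symm
    obtain ⟨j, rfl, hj⟩ : ∃ j, η₂ = [j] ∧ f j = f i := by
      rw [map_eq_singleton_iff] at h₂; exact h₂
    obtain rfl := hf hj
    have hp := wordProd_eq_of_word_eq cs' he
    have hl := congrArg len he
    rw [len_word, len_word] at hl
    have h3 : cs'.wordProd (ω ++ [j]) = cs'.wordProd η₁ := by
      rw [wordProd_append, hp, wordProd_append]; simp
    have h4 := h.eq
    rw [h3] at h4
    have h5 := cs'.length_wordProd_le η₁
    rw [length_append] at h4 hl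
    simp at h4 hl
    omega

end Subgraph

section Spherical

variable {S : Type u} {M : CoxeterMatrix S}

/-- The Coxeter group of a full subgraph embeds, because reduced words stay reduced. -/
theorem IsSpherical.mono {T R : Set S} (hTR : T ⊆ R) (hR : IsSpherical M R) : IsSpherical M T := by
  unfold IsSpherical at hR ⊢
  let f : T → R := Set.inclusion hTR
  let cT := (restrict M T).toCoxeterSystem
  let cR := (restrict M R).toCoxeterSystem
  have hlift : (restrict M T).IsLiftable (fun i => cR.simple (f i)) := fun i j =>
    cR.simple_mul_simple_pow (f i) (f j)
  let φ := cT.lift ⟨_, hlift⟩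
  have hφ : ∀ ω, φ (cT.wordProd ω) = cR.wordProd (ω.map f) := by
    intro ω
    induction ω with
    | nil => simp
    | cons i ω ih =>
      rw [wordProd_cons, map_mul, ih, map_cons, wordProd_cons]
      congr 1
  have hinj : Function.Injective φ := by
    rw [injective_iff_map_eq_one]
    intro w hw
    obtain ⟨ω, hω, rfl⟩ := cT.exists_isReduced w
    rw [hφ] at hw
    have := (isReduced_map cR cT (Set.inclusion_injective hTR) (fun _ _ => rfl) hω).eq
    change cR.length (cR.wordProd (ω.map f)) = (ω.map f).length at this
    rw [hw, cR.length_one, length_map] at this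
    rw [length_eq_zero_iff.1 this.symm, wordProd_nil]
  exact Finite.of_injective φ hinj

variable (M) in
theorem isSpherical_empty : IsSpherical M ∅ := by
  unfold IsSpherical
  let c := (restrict M (∅ : Set S)).toCoxeterSystem
  have : Subsingleton (restrict M (∅ : Set S)).Group := by
    refine ⟨fun x y => ?_⟩
    have key : ∀ x : (restrict M (∅ : Set S)).Group, x = 1 := by
      intro x
      obtain ⟨ω, rfl⟩ := c.wordProd_surjective x
      rcases ω with _ | ⟨i, _⟩
      · simp
      · exact i.2.elim
    rw [key x, key y]
  infer_instance

/-- The generators that divide `a` on the right. -/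
def finalSet (a : ArtinMonoid M) : Set S := {s | ∃ b, a = b * gen M s}

/-- The longest element of the Coxeter group whose lift divides `a` on the right has all the
generators that divide `a` as right descents. -/
theorem exists_forall_isRightDescent (a : ArtinMonoid M) :
    ∃ h : M.Group, ∀ s ∈ finalSet a, M.toCoxeterSystem.IsRightDescent h s := by
  set cs := M.toCoxeterSystem
  let V : Set M.Group := {v | ∃ e, a = e * lift cs v}
  obtain ⟨h, hV, hmax⟩ := WellFounded.has_min
    (InvImage.wf (fun v => len a - cs.length v) Nat.lt_wfRel.wf) V ⟨1, a, by simp⟩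
  refine ⟨h, fun s hs => ?_⟩
  obtain ⟨b, hb⟩ := hs
  obtain ⟨v, ⟨-, hv⟩, ⟨x, rfl, hx⟩, ⟨y, hy, hyl⟩⟩ := exists_isSuffix_isSuffix cs (lcmUpTo M (len a))
    (d := a) le_rfl (fun _ => True) (fun _ _ _ _ => trivial) (fun _ _ _ _ _ _ _ _ _ => trivial)
    (u₁ := h) (u₂ := cs.simple s) ⟨trivial, hV⟩ ⟨trivial, b, by rw [lift_simple]; exact hb⟩
  have h1 : ∀ v, v ∈ V → cs.length v ≤ len a := by
    rintro v ⟨e, he⟩; rw [he]; simp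
  have h2 := h1 _ hv
  have h3 := h1 _ hV
  have h4 := hmax _ hv
  simp only [InvImage, WellFoundedRelation.rel, not_lt] at h4
  have h5 : x = 1 := by rw [← cs.length_eq_zero_iff]; omega
  rw [h5, one_mul] at hy hyl
  unfold IsRightDescent
  rw [hyl, hy, cs.simple_mul_simple_cancel_right, cs.length_simple]
  omega

/-- The exchange condition never deletes a letter of the reduced word `ω`, so that the letters of `ω`
can be split off from `h` one after the other. -/
theorem exists_eq_mul_wordProd_of_isRightDescent {W : Type*} [Group W] (cs : CoxeterSystem M W)
    {h : W} {ω : List S} (hω : cs.IsReduced ω) (hd : ∀ s ∈ ω, cs.IsRightDescent h s) :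
    ∃ x, h = x * cs.wordProd ω ∧ cs.length h = cs.length x + ω.length := by
  induction ω using reverseRecOn with
  | nil => exact ⟨h, by simp, by simp⟩
  | append_singleton ω i ih =>
    obtain ⟨hr, hi⟩ := isReduced_of_append_singleton cs hω
    obtain ⟨x, hx, hl⟩ := ih hr fun s hs => hd s (by simp [hs])
    have hdi := hd i (by simp)
    rw [hx] at hdi
    rcases mem_rightInvSeq_or_exists_of_isRightDescent cs hdi with hm | hm
    · have h1 := (cs.isRightInversion_of_mem_rightInvSeq hr hm).2
      have h2 := hω.eq
      rw [wordProd_append, wordProd_singleton] at h2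
      rw [h2, hr.eq] at h1
      simp at h1
    · set y := x * (cs.wordProd ω * cs.simple i * (cs.wordProd ω)⁻¹)
      have e : h = y * cs.wordProd (ω ++ [i]) := by
        simp [y, hx, wordProd_append, mul_assoc]
      refine ⟨y, e, ?_⟩
      have h1 := cs.length_mul_le y (cs.wordProd (ω ++ [i]))
      rw [← e, hω.eq] at h1
      simp only [length_append, length_singleton] at h1 ⊢
      omega

/-- The reduced words in these generators are suffixes of one element, hence of bounded length. -/
theorem isSpherical_finalSet [Finite S] (a : ArtinMonoid M) : IsSpherical M (finalSet a) := by
  obtain ⟨h, hh⟩ := exists_forall_isRightDescent a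
  set cs := M.toCoxeterSystem
  let c := (restrict M (finalSet a)).toCoxeterSystem
  unfold IsSpherical
  have hfin : {ω : List (finalSet a) | ω.length ≤ cs.length h}.Finite :=
    List.finite_length_le _ _
  refine Set.finite_univ_iff.1 ((hfin.image c.wordProd).subset ?_)
  intro w _
  obtain ⟨ω, hω, rfl⟩ := c.exists_isReduced w
  refine ⟨ω, ?_, rfl⟩
  have hr := isReduced_map cs c Subtype.val_injective (fun _ _ => rfl) hω
  obtain ⟨x, -, hl⟩ := exists_eq_mul_wordProd_of_isRightDescent cs hr (h := h) (by
    intro s hs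
    obtain ⟨i, -, rfl⟩ := mem_map.1 hs
    exact hh _ i.2)
  rw [length_map] at hl
  rw [Set.mem_ofPred_eq]
  omega

theorem finalSet_eq_empty_iff {a : ArtinMonoid M} : finalSet a = ∅ ↔ a = 1 := by
  constructor
  · intro h
    obtain ⟨ω, rfl⟩ := word_surjective M a
    rcases eq_nil_or_concat ω with rfl | ⟨ω, s, rfl⟩
    · rfl
    · have : s ∈ finalSet (word M (ω.concat s)) := ⟨word M ω, by
        rw [concat_eq_append, word_append, word_singleton]⟩
      rw [h] at this
      exact absurd this (Set.notMem_empty s)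
  · rintro rfl
    ext s
    simp only [finalSet, Set.mem_ofPred_eq, Set.mem_empty_iff_false, iff_false, not_exists]
    intro b hb
    have := congrArg len hb
    simp at this

end Spherical

/-! ### Cosets -/

section Coset

variable {S : Type u} {M : CoxeterMatrix S}

theorem gen_mem_parabolic {T : Set S} {s : S} (hs : s ∈ T) : gen M s ∈ parabolic M T :=
  Submonoid.subset_closure ⟨s, hs, rfl⟩

theorem parabolic_mono {T R : Set S} (h : T ⊆ R) : parabolic M T ≤ parabolic M R :=
  Submonoid.closure_mono (Set.image_mono h)

theorem eq_one_or_of_mem_parabolic {T : Set S} {x : ArtinMonoid M} (hx : x ∈ parabolic M T) :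
    x = 1 ∨ ∃ y ∈ parabolic M T, ∃ s ∈ T, x = y * gen M s := by
  induction hx using Submonoid.closure_induction_right with
  | one => exact Or.inl rfl
  | mul_right x hx y hy _ =>
    obtain ⟨s, hs, rfl⟩ := hy
    exact Or.inr ⟨x, hx, s, hs, rfl⟩

theorem word_alternatingWord_mem_parabolic {T : Set S} {s t : S} (hs : s ∈ T) (ht : t ∈ T)
    (k : ℕ) : word M (alternatingWord s t k) ∈ parabolic M T := by
  induction k generalizing s t with
  | zero => exact one_mem _
  | succ k ih =>
    rw [word_alternatingWord_succ]
    exact mul_mem (ih ht hs) (gen_mem_parabolic ht)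

/-- Only generators from `T` divide elements of `A_T⁺` on the right. -/
theorem mem_of_mul_gen_mem_parabolic {T : Set S} {x : ArtinMonoid M} {s : S}
    (h : x * gen M s ∈ parabolic M T) : s ∈ T := by
  classical
  by_contra hs
  -- The homomorphism to `(ℕ, ·)` that detects the letter `s`.
  let g : S → ℕ := fun t => if t = s then 0 else 1
  have key : ∀ ω : List S, FreeMonoid.lift g (FreeMonoid.ofList ω) = if s ∈ ω then 0 else 1 := by
    intro ω
    induction ω with
    | nil => simp
    | cons t ω ih =>
      rw [FreeMonoid.ofList_cons, map_mul, ih, FreeMonoid.lift_eval_of]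
      by_cases hts : t = s
      · simp [g, hts]
      · simp [g, hts, Ne.symm hts]
  have hrel : ∀ a b, BraidRel M a b → FreeMonoid.lift g a = FreeMonoid.lift g b := by
    rintro _ _ ⟨i, j, hij, h0⟩
    rw [key, key]
    simp only [mem_braidWord_iff hij h0, mem_braidWord_iff hij.symm (M.symmetric i j ▸ h0), or_comm]
  let φ : ArtinMonoid M →* ℕ := PresentedMonoid.lift g hrel
  have hφ : ∀ t, φ (gen M t) = g t := fun t => rfl
  have h1 : parabolic M T ≤ (⊥ : Submonoid ℕ).comap φ := by
    rw [parabolic, Submonoid.closure_le]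
    rintro _ ⟨t, ht, rfl⟩
    change φ (gen M t) ∈ (⊥ : Submonoid ℕ)
    rw [hφ]
    have : t ≠ s := fun h => hs (h ▸ ht)
    simp [g, this]
  have h2 := h1 h
  simp [hφ, g] at h2

theorem CosetStep.symm {T : Set S} {a b : ArtinMonoid M} (h : CosetStep M T a b) :
    CosetStep M T b a := by
  obtain ⟨t, ht, t', ht', e⟩ := h
  exact ⟨t', ht', t, ht, e.symm⟩

theorem cosetStep_mul {T : Set S} {a x : ArtinMonoid M} (hx : x ∈ parabolic M T) :
    CosetStep M T a (a * x) :=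
  ⟨x, hx, 1, one_mem _, by simp⟩

theorem CosetStep.mono {T R : Set S} (hTR : T ⊆ R) {a b : ArtinMonoid M} (h : CosetStep M T a b) :
    CosetStep M R a b := by
  obtain ⟨t, ht, t', ht', e⟩ := h
  exact ⟨t, parabolic_mono hTR ht, t', parabolic_mono hTR ht', e⟩

theorem self_mem_coset (a : ArtinMonoid M) (T : Set S) : a ∈ coset M a T :=
  .single ⟨1, one_mem _, 1, one_mem _, rfl⟩

theorem mem_coset_iff {T : Set S} {a b : ArtinMonoid M} :
    b ∈ coset M a T ↔ coset M a T = coset M b T := by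
  constructor
  · intro h
    have h' : Relation.TransGen (CosetStep M T) b a := by
      have := Relation.TransGen.swap _ _ h
      exact Relation.TransGen.mono (fun _ _ => CosetStep.symm) _ _ this
    ext c
    exact ⟨fun hc => h'.trans hc, fun hc => Relation.TransGen.trans h hc⟩
  · intro h
    rw [h]
    exact self_mem_coset b T

theorem coset_eq_coset_mul {T : Set S} {a x : ArtinMonoid M} (hx : x ∈ parabolic M T) :
    coset M a T = coset M (a * x) T :=
  mem_coset_iff.1 (.single (cosetStep_mul hx))

theorem coset_subset_coset {T R : Set S} (hTR : T ⊆ R) (a : ArtinMonoid M) :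
    coset M a T ⊆ coset M a R :=
  fun _ h => Relation.TransGen.mono (fun _ _ => CosetStep.mono hTR) _ _ h

theorem coset_eq_of_subset {T R : Set S} (hTR : T ⊆ R) {a b : ArtinMonoid M}
    (h : coset M a T = coset M b T) : coset M a R = coset M b R :=
  mem_coset_iff.1 (coset_subset_coset hTR a (mem_coset_iff.2 h))

/-- If no generator of `T` divides `a` on the right, then `a A_T⁺` is closed under division by
elements of `A_T⁺`. -/
theorem exists_eq_mul_of_mul_eq_mul {T : Set S} {a : ArtinMonoid M} (ha : Disjoint T (finalSet a))
    {b x y : ArtinMonoid M} (hx : x ∈ parabolic M T) (hy : y ∈ parabolic M T)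
    (h : a * x = b * y) : ∃ z ∈ parabolic M T, b = a * z := by
  induction hn : len (a * x) using Nat.strong_induction_on generalizing b x y with
  | _ n ih =>
    rcases eq_one_or_of_mem_parabolic hy with rfl | ⟨y', hy', s, hs, rfl⟩
    · exact ⟨x, hx, by rw [h, mul_one]⟩
    rcases eq_one_or_of_mem_parabolic hx with rfl | ⟨x', hx', r, hr, rfl⟩
    · exact absurd ⟨b * y', by rw [mul_assoc, ← h, mul_one]⟩ (Set.disjoint_left.1 ha hs)
    rw [← mul_assoc, ← mul_assoc] at h
    have hlen := congrArg len h
    rcases lcmRel_of_mul_gen_eq h with ⟨h', -⟩ | ⟨-, -, c, hc, hc'⟩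
    · exact ih _ (by rw [← hn]; simp) hx' hy' h' rfl
    · obtain ⟨z, hz, rfl⟩ := ih _ (by rw [← hn]; simp) hx'
        (word_alternatingWord_mem_parabolic hr hs _) hc rfl
      rw [mul_assoc] at hc'
      refine ih _ ?_ (mul_mem hz (word_alternatingWord_mem_parabolic hs hr _)) hy' hc'.symm rfl
      rw [← hc', ← hn]
      simp at hlen ⊢
      omega

theorem exists_eq_mul_of_coset_eq {T : Set S} {a : ArtinMonoid M} (ha : Disjoint T (finalSet a))
    {b : ArtinMonoid M} (h : coset M a T = coset M b T) : ∃ z ∈ parabolic M T, b = a * z := by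
  have h' : Relation.TransGen (CosetStep M T) a b := mem_coset_iff.2 h
  clear h
  have step : ∀ {b c : ArtinMonoid M}, (∃ z ∈ parabolic M T, b = a * z) → CosetStep M T b c →
      ∃ z ∈ parabolic M T, c = a * z := by
    rintro b c ⟨z, hz, rfl⟩ ⟨t, ht, t', ht', e⟩
    rw [mul_assoc] at e
    exact exists_eq_mul_of_mul_eq_mul ha (mul_mem hz ht) ht' e
  induction h' with
  | single h => exact step ⟨1, one_mem _, by simp⟩ h
  | tail _ h ih => exact step ih h

theorem eq_or_len_lt_of_coset_eq {T : Set S} {a b : ArtinMonoid M} (ha : Disjoint T (finalSet a))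
    (h : coset M a T = coset M b T) : b = a ∨ len a < len b := by
  obtain ⟨z, -, rfl⟩ := exists_eq_mul_of_coset_eq ha h
  rcases Nat.eq_zero_or_pos (len z) with hz | hz
  · left; rw [len_eq_zero_iff.1 hz, mul_one]
  · right; simp [hz]

theorem exists_coset_eq_of_mem_finalSet {T : Set S} {a : ArtinMonoid M} {s : S}
    (ha : s ∈ finalSet a) (hs : s ∈ T) : ∃ b, coset M a T = coset M b T ∧ len b < len a := by
  obtain ⟨b, rfl⟩ := ha
  exact ⟨b, (coset_eq_coset_mul (gen_mem_parabolic hs)).symm, by simp⟩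

theorem exists_reduced_coset_eq (T : Set S) (a : ArtinMonoid M) :
    ∃ b, coset M a T = coset M b T ∧ Disjoint T (finalSet b) := by
  induction hn : len a using Nat.strong_induction_on generalizing a with
  | _ n ih =>
    by_cases h : Disjoint T (finalSet a)
    · exact ⟨a, rfl, h⟩
    · obtain ⟨s, hs, ha⟩ := Set.not_disjoint_iff.1 h
      obtain ⟨b, hb, hl⟩ := exists_coset_eq_of_mem_finalSet ha hs
      obtain ⟨c, hc, hd⟩ := ih _ (hn ▸ hl) b rfl
      exact ⟨c, hb.trans hc, hd⟩

/-- In particular, a coset `[a]_T` determines `T`. -/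
theorem subset_of_coset_subset {T R : Set S} {a b : ArtinMonoid M}
    (h : coset M a T ⊆ coset M b R) : T ⊆ R := by
  intro s hs
  obtain ⟨c, hc, hd⟩ := exists_reduced_coset_eq R b
  rw [hc] at h
  obtain ⟨x, hx, rfl⟩ := exists_eq_mul_of_coset_eq hd (mem_coset_iff.1 (h (self_mem_coset a T)))
  obtain ⟨y, hy, e⟩ := exists_eq_mul_of_coset_eq hd (mem_coset_iff.1 (h
    (Relation.TransGen.single (cosetStep_mul (gen_mem_parabolic hs)))))
  rw [mul_assoc] at e
  have := mul_left_cancel e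
  exact mem_of_mul_gen_mem_parabolic (this ▸ hy)

end Coset

end

section

open scoped unitInterval

/-! ### Pushing the fundamental chamber into its walls -/

section Chamber

variable {S : Type u} {M : CoxeterMatrix S}

variable (M) in
/-- The fundamental chamber: the union of the cubes `[0,1]^T` with `T` spherical, as the set of the
points of `[0,1]^S` with spherical support. -/
abbrev Chamber : Type u := {x : S → I // IsSpherical M {s | x s ≠ 0}}

/-- The set of coordinates equal to `1`: the type of the bottom of the smallest cube around `x`. -/
def ones (x : Chamber M) : Set S := {s | x.1 s = 1}

open scoped Classical in
/-- The largest coordinate of `x` indexed by `E`, and `0` if `E` is empty. -/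
noncomputable def maxOn [Finite S] (E : Set S) (x : S → I) : I :=
  (Set.toFinite E).toFinset.sup x

variable [Finite S]

theorem continuous_maxOn (E : Set S) : Continuous (maxOn E) := by
  unfold maxOn
  exact Continuous.finset_sup_apply fun i _ => continuous_apply i

theorem le_maxOn {E : Set S} {s : S} (hs : s ∈ E) (x : S → I) : x s ≤ maxOn E x :=
  Finset.le_sup (f := x) (by simpa using hs)

theorem exists_eq_maxOn {E : Set S} (hE : E.Nonempty) (x : S → I) : ∃ s ∈ E, x s = maxOn E x := by
  obtain ⟨s, hs, h⟩ := Finset.exists_mem_eq_sup (Set.toFinite E).toFinset (by simpa using hE) x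
  exact ⟨s, by simpa using hs, h.symm⟩

theorem maxOn_empty (x : S → I) : maxOn ∅ x = 0 := by
  simp only [maxOn, Set.toFinite_toFinset, Set.toFinset_empty, Finset.sup_empty]
  rfl

open scoped Classical in
/-- The coordinates of the deformation of the chamber towards the walls `x_s = 1`, `s ∈ E`. Let `a`
be the largest coordinate in `E`. In the first half of the time, the coordinates outside `E` are
scaled down, to `0` if `a ≤ 1/4`. In the second half, those in `E` move linearly to values with
maximum `1`, by scaling alone if `1/4 ≤ a`; so the support grows only if `a < 1/4`, when it lies in
`E` already. -/
noncomputable def pushCoord (E : Set S) (x : S → I) (t : I) (s : S) : ℝ :=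
  if s ∈ E then
    (x s : ℝ) + max 0 (2 * (t : ℝ) - 1) *
      (x s / max (maxOn E x : ℝ) (1 / 4) + (1 - min 1 (4 * (maxOn E x : ℝ))) - x s)
  else x s * (1 - min 1 (2 * (t : ℝ)) * (1 - max 0 (min 1 (4 * (maxOn E x : ℝ) - 1))))

/-- The same with values in `[0,1]`; truncation does not change anything. -/
noncomputable def pushFun (E : Set S) (x : S → I) (t : I) (s : S) : I :=
  Set.projIcc 0 1 zero_le_one (pushCoord E x t s)

theorem pushFun_eq_of_pushCoord_eq {E : Set S} {x : S → I} {t : I} {s : S} {c : I}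
    (h : pushCoord E x t s = c) : pushFun E x t s = c := by
  rw [pushFun, h, Set.projIcc_val]

theorem isSpherical_support_pushFun {E : Set S} (hE : IsSpherical M E) (x : Chamber M) (t : I) :
    IsSpherical M {s | pushFun E x.1 t s ≠ 0} := by
  by_cases h : (maxOn E x.1 : ℝ) ≤ 1 / 4 ∧ 1 < 2 * (t : ℝ)
  · refine hE.mono fun s hs => ?_
    by_contra hsE
    refine hs (pushFun_eq_of_pushCoord_eq ?_)
    have h1 : min 1 (2 * (t : ℝ)) = 1 := min_eq_left h.2.le
    have h2 : max 0 (min 1 (4 * (maxOn E x.1 : ℝ) - 1)) = 0 :=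
      max_eq_left (min_le_of_right_le (by linarith [h.1]))
    rw [pushCoord, if_neg hsE, h1, h2]
    simp
  · refine IsSpherical.mono (R := {s | x.1 s ≠ 0}) (fun s hs hxs => ?_) x.2
    refine hs (pushFun_eq_of_pushCoord_eq ?_)
    rw [not_and_or, not_le, not_lt] at h
    rw [pushCoord, hxs]
    split_ifs
    · rcases h with h | h
      · rw [min_eq_left (by linarith)]
        simp
      · rw [max_eq_left (by linarith : 2 * (t : ℝ) - 1 ≤ 0)]
        simp
    · simp

/-- The deformation of the chamber towards the walls `x_s = 1`, `s ∈ E`. -/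
noncomputable def push (E : Set S) (hE : IsSpherical M E) (x : Chamber M) (t : I) : Chamber M :=
  ⟨pushFun E x.1 t, isSpherical_support_pushFun hE x t⟩

theorem continuous_push (E : Set S) (hE : IsSpherical M E) :
    Continuous fun p : Chamber M × I => push E hE p.1 p.2 := by
  refine Continuous.subtype_mk (continuous_pi fun s => continuous_projIcc.comp ?_) _
  have h1 : Continuous fun p : Chamber M × I => (p.1.1 s : ℝ) :=
    continuous_subtype_val.comp
      ((continuous_apply s).comp (continuous_subtype_val.comp continuous_fst))
  have h2 : Continuous fun p : Chamber M × I => (maxOn E p.1.1 : ℝ) :=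
    continuous_subtype_val.comp
      ((continuous_maxOn E).comp (continuous_subtype_val.comp continuous_fst))
  have h3 : Continuous fun p : Chamber M × I => (p.2 : ℝ) :=
    continuous_subtype_val.comp continuous_snd
  unfold pushCoord
  split_ifs
  · have h4 : ∀ p : Chamber M × I, max (maxOn E p.1.1 : ℝ) (1 / 4) ≠ 0 := fun p =>
      (lt_max_of_lt_right (by norm_num)).ne'
    fun_prop (disch := exact h4 _)
  · fun_prop

theorem push_zero (E : Set S) (hE : IsSpherical M E) (x : Chamber M) : push E hE x 0 = x := by
  refine Subtype.ext (funext fun s => pushFun_eq_of_pushCoord_eq ?_)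
  rw [pushCoord]
  split_ifs <;> simp

theorem push_of_mem_ones {E : Set S} (hE : IsSpherical M E) {x : Chamber M} {s : S} (hs : s ∈ E)
    (hx : s ∈ ones x) (t : I) : push E hE x t = x := by
  have h1 : maxOn E x.1 = 1 := le_antisymm le_top (by
    have := le_maxOn hs x.1
    rwa [show x.1 s = 1 from hx] at this)
  refine Subtype.ext (funext fun s => pushFun_eq_of_pushCoord_eq ?_)
  rw [pushCoord, h1]
  split_ifs <;> norm_num

theorem exists_mem_ones_push_one {E : Set S} (hE : IsSpherical M E) (hne : E.Nonempty)
    (x : Chamber M) : ∃ s ∈ E, s ∈ ones (push E hE x 1) := by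
  obtain ⟨s, hs, h⟩ := exists_eq_maxOn hne x.1
  refine ⟨s, hs, pushFun_eq_of_pushCoord_eq ?_⟩
  rw [pushCoord, if_pos hs, h]
  generalize (maxOn E x.1 : ℝ) = a
  norm_num
  rcases le_total (1 / 4) a with ha | ha
  · rw [max_eq_left ha, min_eq_left (by linarith), div_self (by linarith)]; ring
  · rw [max_eq_right ha, min_eq_right (by linarith)]; ring

/-- The point of the chamber with all coordinates `0`. -/
def chamberZero : Chamber M :=
  ⟨fun _ => 0, (isSpherical_empty M).mono fun _ h => h rfl⟩

theorem push_one_of_eq_empty {E : Set S} (hE : IsSpherical M E) (he : E = ∅) (x : Chamber M) :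
    push E hE x 1 = chamberZero := by
  subst he
  refine Subtype.ext (funext fun s => pushFun_eq_of_pushCoord_eq ?_)
  rw [pushCoord, if_neg (Set.notMem_empty s), maxOn_empty]
  norm_num [chamberZero]

end Chamber

/-! ### The development of the chamber and its contraction -/

section Development

variable {S : Type u} {M : CoxeterMatrix S}

/-- Two copies of a point `x` of the chamber are identified if their labels lie in the same coset of
the type `{s | x s = 1}`. -/
def DevRel (M : CoxeterMatrix S) (p q : Σ _ : ArtinMonoid M, Chamber M) : Prop :=
  p.2 = q.2 ∧ coset M p.1 (ones p.2) = coset M q.1 (ones p.2)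

/-- The development of the chamber: one copy of the chamber for each element of the Artin monoid,
glued along walls. It is another description of the monoid Deligne complex. -/
abbrev Development (M : CoxeterMatrix S) : Type u := Quot (DevRel M)

/-- The point with coordinates `x` of the chamber labelled by `a`. -/
def devMk (a : ArtinMonoid M) (x : Chamber M) : Development M := Quot.mk _ ⟨a, x⟩

theorem devMk_eq {a b : ArtinMonoid M} {x : Chamber M}
    (h : coset M a (ones x) = coset M b (ones x)) : devMk a x = devMk b x :=
  Quot.sound ⟨rfl, h⟩

theorem continuous_devMk (a : ArtinMonoid M) : Continuous (devMk a) :=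
  continuous_quot_mk.comp continuous_sigmaMk

/-- The shortest element of the coset `[a]_T`. -/
noncomputable def reduce (T : Set S) (a : ArtinMonoid M) : ArtinMonoid M :=
  (exists_reduced_coset_eq T a).choose

theorem coset_eq_coset_reduce (T : Set S) (a : ArtinMonoid M) :
    coset M a T = coset M (reduce T a) T :=
  (exists_reduced_coset_eq T a).choose_spec.1

theorem disjoint_finalSet_reduce (T : Set S) (a : ArtinMonoid M) :
    Disjoint T (finalSet (reduce T a)) :=
  (exists_reduced_coset_eq T a).choose_spec.2

theorem eq_reduce_or_len_lt {T : Set S} {a b : ArtinMonoid M} (h : coset M a T = coset M b T) :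
    b = reduce T a ∨ len (reduce T a) < len b :=
  eq_or_len_lt_of_coset_eq (disjoint_finalSet_reduce T a) ((coset_eq_coset_reduce T a).symm.trans h)

theorem reduce_eq_reduce {T : Set S} {a b : ArtinMonoid M} (h : coset M a T = coset M b T) :
    reduce T a = reduce T b := by
  have h1 := eq_reduce_or_len_lt (h.trans (coset_eq_coset_reduce T b))
  have h2 := eq_reduce_or_len_lt (h.symm.trans (coset_eq_coset_reduce T a))
  rcases h1 with h1 | h1
  · exact h1.symm
  · rcases h2 with h2 | h2
    · exact h2
    · omega

variable [Finite S]

open scoped Classical in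
/-- The `n`-th stage of the contraction: a point whose chamber of smallest length has label `b` of
length `n` is pushed inside this chamber towards the walls which separate it from shorter ones;
other points are fixed. It is continuous only on the union of the chambers of length at most `n`. -/
noncomputable def stage (n : ℕ) (t : I) : Development M → Development M :=
  Quot.lift (fun p => if len (reduce (ones p.2) p.1) = n then
      devMk (reduce (ones p.2) p.1) (push _ (isSpherical_finalSet (reduce (ones p.2) p.1)) p.2 t)
    else devMk p.1 p.2) (by
  rintro ⟨a, x⟩ ⟨b, y⟩ ⟨h1, h⟩
  obtain rfl : x = y := h1
  simp only [reduce_eq_reduce h, devMk_eq h])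

theorem stage_devMk_of_lt {n : ℕ} {a : ArtinMonoid M} (h : len a < n) (x : Chamber M) (t : I) :
    stage n t (devMk a x) = devMk a x := by
  refine if_neg ?_
  rcases eq_reduce_or_len_lt (rfl : coset M a (ones x) = coset M a (ones x)) with h' | h'
  · rw [← h']; exact h.ne
  · exact (h'.trans h).ne

theorem stage_devMk_of_eq {n : ℕ} {a : ArtinMonoid M} (h : len a = n) (x : Chamber M) (t : I) :
    stage n t (devMk a x) = devMk a (push _ (isSpherical_finalSet a) x t) := by
  rcases eq_reduce_or_len_lt (rfl : coset M a (ones x) = coset M a (ones x)) with h' | h'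
  · refine (if_pos ?_).trans ?_
    · rw [← h']; exact h
    · simp only [← h']
  · refine (if_neg (h ▸ h'.ne)).trans ?_
    obtain ⟨s, hs, hsa⟩ : ∃ s ∈ ones x, s ∈ finalSet a := by
      by_contra hcon
      push Not at hcon
      rcases eq_or_len_lt_of_coset_eq (Set.disjoint_left.2 hcon) (coset_eq_coset_reduce _ a)
        with h2 | h2
      · rw [h2] at h'; exact lt_irrefl _ h'
      · exact lt_asymm h' h2
    rw [push_of_mem_ones _ hsa hs]

theorem stage_zero (n : ℕ) (p : Development M) : stage n 0 p = p := by
  obtain ⟨⟨a, x⟩, rfl⟩ := Quot.exists_rep p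
  change (if _ then _ else _) = devMk a x
  split_ifs
  · rw [push_zero]
    exact (devMk_eq (coset_eq_coset_reduce _ a)).symm
  · rfl

/-- The clock of stage `n`: it runs from `0` to `1` while `τ` runs from `1/(n+2)` to `1/(n+1)`. -/
noncomputable def clock (n : ℕ) (τ : I) : I :=
  Set.projIcc 0 1 zero_le_one ((n + 1) * ((n + 2) * τ - 1))

theorem continuous_clock (n : ℕ) : Continuous (clock n) :=
  continuous_projIcc.comp (by fun_prop)

theorem clock_eq_zero {n : ℕ} {τ : I} (h : (n + 2) * (τ : ℝ) ≤ 1) : clock n τ = 0 :=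
  Set.projIcc_of_le_left _ (mul_nonpos_of_nonneg_of_nonpos (by positivity) (by linarith))

theorem clock_eq_one {n : ℕ} {τ : I} (h : 1 ≤ (n + 1) * (τ : ℝ)) : clock n τ = 1 :=
  Set.projIcc_of_right_le _ (by
    have h0 : (0 : ℝ) ≤ n + 1 := by positivity
    nlinarith [τ.2.1])

/-- The composite of the stages `n, …, 1, 0`, each run by its own clock. -/
noncomputable def flow : ℕ → Development M → I → Development M
  | 0, p, τ => stage 0 (clock 0 τ) p
  | n + 1, p, τ => flow n (stage (n + 1) (clock (n + 1) τ) p) τ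

theorem flow_of_le {n : ℕ} {τ : I} (h : (n + 2) * (τ : ℝ) ≤ 1) (p : Development M) :
    flow n p τ = p := by
  induction n with
  | zero => rw [flow, clock_eq_zero h, stage_zero]
  | succ n ih =>
    rw [flow, clock_eq_zero h, stage_zero]
    apply ih
    push_cast at h
    nlinarith [τ.2.1]

theorem flow_devMk_of_le {n : ℕ} {a : ArtinMonoid M} (h : len a ≤ n) (x : Chamber M) (τ : I) :
    flow n (devMk a x) τ = flow (len a) (devMk a x) τ := by
  induction n, h using Nat.le_induction with
  | base => rfl
  | succ n hn ih => rw [flow, stage_devMk_of_lt (by omega), ih]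

theorem flow_len_eq {a b : ArtinMonoid M} {x y : Chamber M} (h : devMk a x = devMk b y) (τ : I) :
    flow (len a) (devMk a x) τ = flow (len b) (devMk b y) τ := by
  rw [← flow_devMk_of_le (le_max_left (len a) (len b)), h,
    ← flow_devMk_of_le (le_max_right (len a) (len b)) y]

theorem flow_devMk_one {n : ℕ} {a : ArtinMonoid M} (h : len a ≤ n) (x : Chamber M) :
    flow n (devMk a x) 1 = devMk 1 chamberZero := by
  induction n generalizing a x with
  | zero =>
    have ha := len_eq_zero_iff.1 (Nat.le_zero.1 h)
    rw [flow, clock_eq_one (by simp), stage_devMk_of_eq (Nat.le_zero.1 h),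
      push_one_of_eq_empty _ (finalSet_eq_empty_iff.2 ha), ha]
  | succ n ih =>
    rcases h.lt_or_eq with h | h
    · rw [flow, stage_devMk_of_lt h, ih (by omega)]
    · have hne : (finalSet a).Nonempty := by
        rw [Set.nonempty_iff_ne_empty, Ne, finalSet_eq_empty_iff, ← len_eq_zero_iff]
        omega
      rw [flow, clock_eq_one (by simp; positivity), stage_devMk_of_eq h]
      obtain ⟨s, hs, h1⟩ := exists_mem_ones_push_one (isSpherical_finalSet a) hne x
      obtain ⟨b, hb, hl⟩ := exists_coset_eq_of_mem_finalSet hs h1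
      rw [devMk_eq hb, ih (by omega)]

/-- On the chambers of length at most `n`, the flow through the stages `n, …, 0` is continuous:
before stage `n` has ended, the stages `n - 1, …, 0` have not begun; when it has ended, the point lies in
one of the finitely many closed walls, along each of which a shorter chamber is adjacent. -/
theorem continuous_flow {n : ℕ} {a : ArtinMonoid M} (h : len a ≤ n) :
    Continuous fun p : Chamber M × I => flow n (devMk a p.1) p.2 := by
  induction n generalizing a with
  | zero =>
    simp only [flow, stage_devMk_of_eq (Nat.le_zero.1 h)]
    exact (continuous_devMk a).comp ((continuous_push _ (isSpherical_finalSet a)).comp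
      (continuous_fst.prodMk ((continuous_clock 0).comp continuous_snd)))
  | succ n ih =>
    rcases h.lt_or_eq with h | h
    · simp only [flow, stage_devMk_of_lt h]
      exact ih (by omega)
    have hne : (finalSet a).Nonempty := by
      rw [Set.nonempty_iff_ne_empty, Ne, finalSet_eq_empty_iff, ← len_eq_zero_iff]
      omega
    simp only [flow, stage_devMk_of_eq h]
    set E := finalSet a
    set hE := isSpherical_finalSet a
    -- `none` stands for the times before the end of stage `n + 1`, `some s` for the wall of `s`.
    let C : Option E → Set (Chamber M × I) := fun o => match o with
      | none => {p | ((n : ℝ) + 2) * p.2 ≤ 1}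
      | some s => {p | 1 ≤ ((n : ℝ) + 2) * p.2} ∩ {p | (push E hE p.1 1).1 s = 1}
    have hpush : Continuous fun p : Chamber M × I => push E hE p.1 1 :=
      (continuous_push E hE).comp (continuous_fst.prodMk continuous_const)
    have hclosed : ∀ o, IsClosed (C o) := by
      rintro (_ | s)
      · exact isClosed_le (by fun_prop) continuous_const
      · exact (isClosed_le continuous_const (by fun_prop)).inter
          (isClosed_eq ((continuous_apply s.1).comp (continuous_subtype_val.comp hpush))
            continuous_const)
    have hcover : ⋃ o, C o = Set.univ := by
      rw [Set.eq_univ_iff_forall]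
      intro p
      rw [Set.mem_iUnion]
      rcases le_total (((n : ℝ) + 2) * p.2) 1 with hp | hp
      · exact ⟨none, hp⟩
      · obtain ⟨s, hs, h1⟩ := exists_mem_ones_push_one hE hne p.1
        exact ⟨some ⟨s, hs⟩, hp, h1⟩
    refine (locallyFinite_of_finite C).continuous hcover hclosed ?_
    rintro (_ | s)
    · refine ContinuousOn.congr (f := fun p : Chamber M × I =>
        devMk a (push E hE p.1 (clock (n + 1) p.2))) ?_ fun p hp => flow_of_le hp _
      exact ((continuous_devMk a).comp ((continuous_push E hE).comp
        (continuous_fst.prodMk ((continuous_clock _).comp continuous_snd)))).continuousOn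
    · obtain ⟨b, hb⟩ := s.2
      have hlb : len b ≤ n := by rw [hb] at h; simp at h; omega
      refine ContinuousOn.congr (f := fun p : Chamber M × I =>
        flow n (devMk b (push E hE p.1 1)) p.2) ?_ fun p hp => ?_
      · exact ((ih hlb).comp (hpush.prodMk continuous_snd)).continuousOn
      · have hp1 : 1 ≤ ((n + 1 : ℕ) + 1) * (p.2 : ℝ) := by
          have := hp.1
          rw [Set.mem_ofPred_eq] at this
          push_cast
          linarith
        rw [clock_eq_one hp1]
        congr 1
        exact devMk_eq ((congrArg (fun c => coset M c _) hb).trans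
          (coset_eq_coset_mul (gen_mem_parabolic (T := ones (push E hE p.1 1)) hp.2)).symm)

variable (M) in
/-- The contraction of the development, as a map to paths. -/
noncomputable def contraction : C(Development M, C(I, Development M)) where
  toFun := Quot.lift (fun p => ContinuousMap.curry
      ⟨fun q : Chamber M × I => flow (len p.1) (devMk p.1 q.1) q.2, continuous_flow le_rfl⟩ p.2) (by
    rintro ⟨a, x⟩ ⟨b, y⟩ h
    ext τ
    exact flow_len_eq (Quot.sound h) τ)
  continuous_toFun := by
    refine continuous_quot_lift _ (continuous_sigma fun a => ?_)
    exact (ContinuousMap.curry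
      ⟨fun q : Chamber M × I => flow (len a) (devMk a q.1) q.2, continuous_flow le_rfl⟩).continuous

theorem contractibleSpace_development : ContractibleSpace (Development M) := by
  rw [contractible_iff_id_nullhomotopic]
  refine ⟨devMk 1 chamberZero, ⟨⟨⟨fun p => contraction M p.2 p.1, ?_⟩, ?_, ?_⟩⟩⟩
  · exact (ContinuousMap.continuous_uncurry_of_continuous (contraction M)).comp continuous_swap
  · intro p
    obtain ⟨⟨a, x⟩, rfl⟩ := Quot.exists_rep p
    exact flow_of_le (by simp) _
  · intro p
    obtain ⟨⟨a, x⟩, rfl⟩ := Quot.exists_rep p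
    exact flow_devMk_one le_rfl x

end Development

/-! ### The monoid Deligne complex as a development -/

section Comparison

variable {S : Type u} {M : CoxeterMatrix S}

theorem Vertex.type_mk (a : ArtinMonoid M) {T : Set S} (hT : IsSpherical M T) :
    (Vertex.mk a T hT).type = T := by
  obtain ⟨-, b, hb⟩ := (Vertex.mk a T hT).type_spec
  change coset M a T = _ at hb
  exact (subset_of_coset_subset hb.ge).antisymm (subset_of_coset_subset hb.le)

theorem Vertex.eq_coset {v : Vertex M} {a : ArtinMonoid M} (ha : a ∈ v.1) :
    v.1 = coset M a v.type := by
  obtain ⟨-, b, hb⟩ := v.type_spec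
  rw [hb] at ha ⊢
  exact mem_coset_iff.1 ha

theorem Vertex.nonempty (v : Vertex M) : ∃ a, a ∈ v.1 := by
  obtain ⟨-, b, hb⟩ := v.type_spec
  exact ⟨b, hb ▸ self_mem_coset b _⟩

theorem Vertex.type_mono {v w : Vertex M} (h : v ≤ w) : v.type ⊆ w.type := by
  obtain ⟨-, a, ha⟩ := v.type_spec
  obtain ⟨-, b, hb⟩ := w.type_spec
  exact subset_of_coset_subset (ha ▸ hb ▸ h : coset M a v.type ⊆ coset M b w.type)

theorem Vertex.eq_mk {v : Vertex M} {a : ArtinMonoid M} (ha : a ∈ v.1) :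
    v = Vertex.mk a v.type v.type_spec.1 :=
  Subtype.ext (Vertex.eq_coset ha)

open scoped Classical in
/-- A point of a cube as a point of the chamber: missing coordinates are `1` on the bottom type, and
`0` outside the top type. -/
noncomputable def extend (J : Interval M) (x : Cube J) : Chamber M :=
  ⟨fun s => if hbot : s ∈ J.bot.type then 1
    else if htop : s ∈ J.top.type then x ⟨s, htop, hbot⟩ else 0,
    J.top.type_spec.1.mono fun s hs => by
      by_contra h
      exact hs ((dif_neg fun h' => h (Vertex.type_mono J.le h')).trans (dif_neg h))⟩

theorem extend_of_mem_bot {J : Interval M} (x : Cube J) {s : S} (hs : s ∈ J.bot.type) :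
    (extend J x).1 s = 1 :=
  dif_pos hs

theorem extend_of_mem_top {J : Interval M} (x : Cube J) {s : S} (hs : s ∉ J.bot.type)
    (hs' : s ∈ J.top.type) : (extend J x).1 s = x ⟨s, hs', hs⟩ :=
  (dif_neg hs).trans (dif_pos hs')

theorem extend_of_notMem_top {J : Interval M} (x : Cube J) {s : S} (hs : s ∉ J.top.type) :
    (extend J x).1 s = 0 :=
  (dif_neg fun h => hs (Vertex.type_mono J.le h)).trans (dif_neg hs)

theorem continuous_extend (J : Interval M) : Continuous (extend J) := by
  refine Continuous.subtype_mk (continuous_pi fun s => ?_) _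
  split_ifs
  · exact continuous_const
  · exact continuous_apply _
  · exact continuous_const

theorem extend_faceMap {J K : Interval M} (h : IsFace J K) (x : Cube J) :
    extend K (faceMap J K x) = extend J x := by
  refine Subtype.ext (funext fun s => ?_)
  have h1 := Vertex.type_mono h.1
  have h2 := Vertex.type_mono h.2
  by_cases hK : s ∈ K.bot.type
  · rw [extend_of_mem_bot _ hK, extend_of_mem_bot _ (h1 hK)]
  by_cases hK' : s ∈ K.top.type
  · rw [extend_of_mem_top _ hK hK']
    rfl
  · rw [extend_of_notMem_top _ hK', extend_of_notMem_top _ fun h => hK' (h2 h)]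

theorem devMk_extend_eq {J : Interval M} (x : Cube J) {a b : ArtinMonoid M} (ha : a ∈ J.bot.1)
    (hb : b ∈ J.bot.1) : devMk a (extend J x) = devMk b (extend J x) :=
  devMk_eq (coset_eq_of_subset (fun _ hs => extend_of_mem_bot x hs)
    ((Vertex.eq_coset ha).symm.trans (Vertex.eq_coset hb)))

variable (M) in
/-- The comparison map from the monoid Deligne complex to the development. -/
noncomputable def toDevelopment : MonoidDeligneComplex M → Development M :=
  Quot.lift (fun p => devMk p.1.bot.nonempty.choose (extend p.1 p.2)) (by
    rintro _ _ ⟨J, K, h, x⟩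
    change devMk _ (extend J x) = devMk _ (extend K (faceMap J K x))
    rw [extend_faceMap h]
    exact devMk_extend_eq x J.bot.nonempty.choose_spec (h.1 K.bot.nonempty.choose_spec))

theorem toDevelopment_mk {J : Interval M} (x : Cube J) {a : ArtinMonoid M} (ha : a ∈ J.bot.1) :
    toDevelopment M (Quot.mk _ ⟨J, x⟩) = devMk a (extend J x) :=
  devMk_extend_eq x J.bot.nonempty.choose_spec ha

theorem continuous_toDevelopment : Continuous (toDevelopment M) :=
  continuous_quot_lift _ (continuous_sigma fun J =>
    (continuous_devMk J.bot.nonempty.choose).comp (continuous_extend J))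

/-- The interval `[[a]_T, [a]_R]`. -/
def interval (a : ArtinMonoid M) {T R : Set S} (hTR : T ⊆ R) (hR : IsSpherical M R) :
    Interval M where
  bot := Vertex.mk a T (hR.mono hTR)
  top := Vertex.mk a R hR
  le := coset_subset_coset hTR a

/-- The point of the cube of `[[a]_T, [a]_R]` whose coordinates are those of `y`. -/
def cubePoint (a : ArtinMonoid M) {T R : Set S} (hTR : T ⊆ R) (hR : IsSpherical M R) (y : S → I) :
    MonoidDeligneComplex M :=
  Quot.mk _ ⟨interval a hTR hR, fun s => y s.1⟩

theorem continuous_cubePoint (a : ArtinMonoid M) {T R : Set S} (hTR : T ⊆ R)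
    (hR : IsSpherical M R) : Continuous (cubePoint a hTR hR) :=
  continuous_quot_mk.comp (continuous_sigmaMk.comp (continuous_pi fun s => continuous_apply s.1))

theorem cubePoint_eq_of_face (a : ArtinMonoid M) {T T' R' R : Set S} (h₁ : T ⊆ T') (h₂ : T' ⊆ R')
    (h₃ : R' ⊆ R) (hR : IsSpherical M R) {y : S → I} (hy₁ : ∀ s ∈ T', y s = 1)
    (hy₀ : ∀ s, s ∉ R' → y s = 0) :
    cubePoint a h₂ (hR.mono h₃) y = cubePoint a (h₁.trans (h₂.trans h₃)) hR y := by
  have hface : IsFace (interval a h₂ (hR.mono h₃)) (interval a (h₁.trans (h₂.trans h₃)) hR) :=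
    ⟨coset_subset_coset h₁ a, coset_subset_coset h₃ a⟩
  refine (Quot.sound (Glue.face _ _ hface _)).trans ?_
  unfold cubePoint
  congr 2
  funext s
  unfold faceMap
  split_ifs with hb ht
  · refine (hy₁ _ ?_).symm
    change s.1 ∈ (Vertex.mk a T' ((hR.mono h₃).mono h₂)).type at hb
    rwa [Vertex.type_mk] at hb
  · rfl
  · refine (hy₀ _ fun h => ht ?_).symm
    change s.1 ∈ (Vertex.mk a R' (hR.mono h₃)).type
    rwa [Vertex.type_mk]

theorem cubePoint_congr {a b : ArtinMonoid M} {T R : Set S} (hTR : T ⊆ R) (hR : IsSpherical M R)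
    (h : coset M a T = coset M b T) (y : S → I) : cubePoint a hTR hR y = cubePoint b hTR hR y := by
  have h' : interval a hTR hR = interval b hTR hR := by
    unfold interval Vertex.mk
    simp only [h, coset_eq_of_subset hTR h]
  unfold cubePoint
  rw [h']

theorem ones_subset_support (x : Chamber M) : ones x ⊆ {s | x.1 s ≠ 0} := by
  intro s hs
  change x.1 s = 1 at hs
  change x.1 s ≠ 0
  rw [hs]
  exact one_ne_zero

variable (M) in
/-- The comparison map from the development to the monoid Deligne complex. -/
noncomputable def ofDevelopment : Development M → MonoidDeligneComplex M :=
  Quot.lift (fun p => cubePoint p.1 (Set.empty_subset _) p.2.2 p.2.1) (by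
    rintro ⟨a, x⟩ ⟨b, y⟩ ⟨h1, h⟩
    obtain rfl : x = y := h1
    have key : ∀ c : ArtinMonoid M, cubePoint c (ones_subset_support x) x.2 x.1 =
        cubePoint c (Set.empty_subset _) x.2 x.1 := fun c =>
      cubePoint_eq_of_face c (Set.empty_subset _) (ones_subset_support x) subset_rfl x.2
        (fun _ hs => hs) (fun s hs => not_not.1 hs)
    exact (key a).symm.trans ((cubePoint_congr _ _ h _).trans (key b)))

/-- The comparison map in terms of any cube which contains the point. -/
theorem ofDevelopment_devMk (a : ArtinMonoid M) (x : Chamber M) {T R : Set S} (hTR : T ⊆ R)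
    (hR : IsSpherical M R) (hT : T ⊆ ones x) (hx : ∀ s, s ∉ R → x.1 s = 0) :
    ofDevelopment M (devMk a x) = cubePoint a hTR hR x.1 := by
  have hsupp : {s | x.1 s ≠ 0} ⊆ R := fun s hs => by
    by_contra h
    exact hs (hx s h)
  have h1 : cubePoint a (Set.empty_subset {s | x.1 s ≠ 0}) x.2 x.1 =
      cubePoint a (Set.empty_subset R) hR x.1 :=
    cubePoint_eq_of_face a subset_rfl (Set.empty_subset _) hsupp hR
      (fun s hs => absurd hs (Set.notMem_empty s)) (fun s hs => not_not.1 hs)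
  have h2 : cubePoint a hTR hR x.1 = cubePoint a (Set.empty_subset R) hR x.1 :=
    cubePoint_eq_of_face a (Set.empty_subset _) hTR subset_rfl hR (fun s hs => hT hs) hx
  exact h1.trans h2.symm

theorem continuous_ofDevelopment [Finite S] : Continuous (ofDevelopment M) := by
  refine continuous_quot_lift _ (continuous_sigma fun a => ?_)
  let C : {T : Set S // IsSpherical M T} → Set (Chamber M) := fun T =>
    {x | ∀ s, s ∉ T.1 → x.1 s = 0}
  have hclosed : ∀ T, IsClosed (C T) := by
    intro T
    have : C T = ⋂ s, ⋂ (_ : s ∉ T.1), {x | x.1 s = 0} := by ext x; simp [C]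
    rw [this]
    exact isClosed_iInter fun s => isClosed_iInter fun _ =>
      isClosed_eq ((continuous_apply s).comp continuous_subtype_val) continuous_const
  have hcover : ⋃ T, C T = Set.univ := by
    rw [Set.eq_univ_iff_forall]
    exact fun x => Set.mem_iUnion.2 ⟨⟨_, x.2⟩, fun s hs => not_not.1 hs⟩
  refine (locallyFinite_of_finite C).continuous hcover hclosed fun T => ?_
  refine ContinuousOn.congr (f := fun x : Chamber M => cubePoint a (Set.empty_subset T.1) T.2 x.1)
    ?_ fun x hx => ofDevelopment_devMk a x _ T.2 (Set.empty_subset _) hx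
  exact ((continuous_cubePoint a _ T.2).comp continuous_subtype_val).continuousOn

theorem ofDevelopment_toDevelopment (p : MonoidDeligneComplex M) :
    ofDevelopment M (toDevelopment M p) = p := by
  obtain ⟨⟨J, x⟩, rfl⟩ := Quot.exists_rep p
  obtain ⟨a, ha⟩ := J.bot.nonempty
  have hJ : interval a (Vertex.type_mono J.le) J.top.type_spec.1 = J := by
    have h1 := (Vertex.eq_mk ha).symm
    have h2 := (Vertex.eq_mk (J.le ha)).symm
    obtain ⟨b, t, hle⟩ := J
    unfold interval
    simp only at h1 h2 ⊢
    congr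
  rw [toDevelopment_mk x ha, ofDevelopment_devMk a _ (Vertex.type_mono J.le) J.top.type_spec.1
    (fun s hs => extend_of_mem_bot x hs) (fun s hs => extend_of_notMem_top x hs)]
  unfold cubePoint
  rw [hJ]
  congr 2
  funext s
  exact extend_of_mem_top x s.2.2 s.2.1

theorem toDevelopment_ofDevelopment (p : Development M) :
    toDevelopment M (ofDevelopment M p) = p := by
  obtain ⟨⟨a, x⟩, rfl⟩ := Quot.exists_rep p
  have hbot : (interval a (Set.empty_subset {s | x.1 s ≠ 0}) x.2).bot.type = ∅ :=
    Vertex.type_mk a (isSpherical_empty M)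
  have htop : (interval a (Set.empty_subset {s | x.1 s ≠ 0}) x.2).top.type = {s | x.1 s ≠ 0} :=
    Vertex.type_mk a x.2
  change toDevelopment M (Quot.mk _ ⟨interval a (Set.empty_subset {s | x.1 s ≠ 0}) x.2,
    fun s => x.1 s.1⟩) = devMk a x
  rw [toDevelopment_mk _ (self_mem_coset a _)]
  congr 1
  refine Subtype.ext (funext fun s => ?_)
  by_cases hs : x.1 s = 0
  · rw [extend_of_notMem_top _ (by rw [htop]; exact fun h => h hs), hs]
  · rw [extend_of_mem_top _ (by rw [hbot]; exact Set.notMem_empty s) (by rw [htop]; exact hs)]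

/-- The monoid Deligne complex is homeomorphic to the development of the chamber. -/
noncomputable def homeomorphDevelopment [Finite S] : MonoidDeligneComplex M ≃ₜ Development M where
  toFun := toDevelopment M
  invFun := ofDevelopment M
  left_inv := ofDevelopment_toDevelopment
  right_inv := toDevelopment_ofDevelopment
  continuous_toFun := continuous_toDevelopment
  continuous_invFun := continuous_ofDevelopment

end Comparison

end

end ArtinDeligne

theorem theorem4p1 {S : Type*} [Finite S] (M : CoxeterMatrix S) :
    ContractibleSpace (ArtinDeligne.MonoidDeligneComplex M) := by
  have := ArtinDeligne.contractibleSpace_development (M := M)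
  exact ArtinDeligne.homeomorphDevelopment.contractibleSpace
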